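/- Let $p$ be a prime, $K/\mathbb{Q}_p$ a finite field extension with valuation ring $\mathcal{O}$ and uniformiser $\pi$. Let $\mathfrak{g}$ be a finite-dimensional nilpotent Lie algebra over $K$, and let $\mathcal{L}\subseteq\mathfrak{g}$ be an $\mathcal{O}$-Lie lattice, i.e. an $\mathcal{O}$-submodule closed under the Lie bracket with $\bigcap_{n}\pi^n\mathcal{L}=0$ and $\mathcal{L}\otimes_{\mathcal{O}}K=\mathfrak{g}$. Let $\lambda\in\mathcal{L}^*=\mathrm{Hom}_{\mathcal{O}}(\mathcal{L},\mathcal{O})$, i.e. $\lambda:\mathfrak{g}\to K$ is a $K$-linear form with $\lambda(\mathcal{L})\subseteq\mathcal{O}$. A polarisation of $\mathfrak{g}$ at $\lambda$ is a solvable subalgebra $\mathfrak{b}$ of $\mathfrak{g}$ such that, for all $u\in\mathfrak{g}$, $\lambda([u,\mathfrak{b}])=0$ if and only if $u\in\mathfrak{b}$. For an $\mathcal{O}$-Lie algebra $\mathcal{M}$ write $\widehat{U(\mathcal{M})}_K:=\bigl(\varprojlim_n U(\mathcal{M})/\pi^nU(\mathcal{M})\bigr)\otimes_{\mathcal{O}}K$,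 where $U(\mathcal{M})$ is the universal enveloping algebra. For a polarisation $\mathfrak{b}$ of $\mathfrak{g}$ at $\lambda$ put $\mathcal{B}:=\mathfrak{b}\cap\mathcal{L}$; the character $\lambda|_{\mathcal{B}}:\mathcal{B}\to\mathcal{O}$ extends to $U(\mathcal{B})\to\mathcal{O}$ and then, by $\pi$-adic completion and extension of scalars, to $\widehat{U(\mathcal{B})}_K\to K$, which makes $K_\lambda:=K$ a one-dimensional $\widehat{U(\mathcal{B})}_K$-module. The affinoid Dixmier module of $\mathcal{L}$ at $\lambda$ with respect to $\mathfrak{b}$ is the left $\widehat{U(\mathcal{L})}_K$-module $$\widehat{D(\lambda)}_{\mathfrak{b}}:=\widehat{U(\mathcal{L})}_K\otimes_{\widehat{U(\mathcal{B})}_K}K_\lambda .$$ Then for any two polarisations $\mathfrak{b}_1,\mathfrak{b}_2$ of $\mathfrak{g}$ at $\lambda$, $$\mathrm{Ann}_{\widehat{U(\mathcal{L})}_K}\widehat{D(\lambda)}_{\mathfrak{b}_1}=\mathrm{Ann}_{\widehat{U(\mathcal{L})}_K}\widehat{D(\lambda)}_{\mathfrak{b}_2}.$$ -/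

import Mathlib

open IsLocalRing TensorProduct

noncomputable section

attribute [local instance 100] LieRing.ofAssociativeRing

namespace AffinoidDixmier

section PadicField

variable (p : ℕ) [Fact p.Prime] (K : Type*) [Field K] [Algebra ℚ_[p] K] [FiniteDimensional ℚ_[p] K]

/-- The valuation ring of a finite extension `K` of `ℚ_p`: the elements of absolute value at most
`1`, for the unique absolute value on `K` extending the `p`-adic one. -/
def integers : ValuationSubring K where
  carrier := {x | spectralNorm ℚ_[p] K x ≤ 1}
  one_mem' := spectralNorm_one.le
  zero_mem' := by simp [spectralNorm_zero]
  mul_mem' {x y} hx hy := by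
    have h := spectralAlgNorm_mul (K := ℚ_[p]) x y
    simp only [spectralAlgNorm_def] at h
    simp only [Set.mem_ofPred_eq] at *
    rw [h]
    exact mul_le_one₀ hx (spectralNorm_nonneg _) hy
  add_mem' {x y} hx hy :=
    (isNonarchimedean_spectralNorm x y).trans (max_le hx hy)
  neg_mem' {x} hx := by
    have h : spectralNorm ℚ_[p] K (-x) = spectralNorm ℚ_[p] K x := by
      simpa only [spectralAlgNorm_def] using map_neg_eq_map (spectralAlgNorm ℚ_[p] K) x
    simpa only [Set.mem_ofPred_eq, h] using hx
  mem_or_inv_mem' x := by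
    let i := spectralNorm.normedField ℚ_[p] K
    have h : ∀ y : K, spectralNorm ℚ_[p] K y = ‖y‖ := fun _ ↦ rfl
    change spectralNorm ℚ_[p] K x ≤ 1 ∨ spectralNorm ℚ_[p] K x⁻¹ ≤ 1
    rw [h, h, norm_inv]
    exact (le_total ‖x‖ 1).imp_right fun hx ↦ inv_le_one_of_one_le₀ hx

theorem mem_integers {x : K} : x ∈ integers p K ↔ spectralNorm ℚ_[p] K x ≤ 1 := Iff.rfl

open scoped Valued Pointwise in
instance isAdicComplete_integers :
    IsAdicComplete (maximalIdeal (integers p K)) (integers p K) := by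
  let i := spectralNorm.nontriviallyNormedField ℚ_[p] K
  let j : NormedAlgebra ℚ_[p] K := spectralNorm.normedAlgebra ℚ_[p] K
  have hu : IsUltrametricDist K := IsUltrametricDist.of_normedAlgebra ℚ_[p]
  have hp : ProperSpace K := FiniteDimensional.proper ℚ_[p] K
  let v : Valued K NNReal := NormedField.toValued
  have hc : CompactSpace (integers p K) := by
    refine isCompact_iff_compactSpace.mp ?_
    change IsCompact {x | x ∈ integers p K}
    have h : {x | x ∈ integers p K} = Metric.closedBall (0 : K) 1 := by
      ext x
      simp only [Set.mem_ofPred_eq, mem_closedBall_zero_iff]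
      rfl
    exact h ▸ isCompact_closedBall (0 : K) 1
  have hm : ∀ x : K, x ∈ 𝒪[K] ↔ x ∈ integers p K := fun x ↦ Iff.rfl
  let e : 𝒪[K] ≃+* integers p K :=
    { toFun := fun x ↦ ⟨x.1, (hm _).1 x.2⟩
      invFun := fun x ↦ ⟨x.1, (hm _).2 x.2⟩
      left_inv := fun _ ↦ rfl
      right_inv := fun _ ↦ rfl
      map_mul' := fun _ _ ↦ rfl
      map_add' := fun _ _ ↦ rfl }
  have hc' : CompactSpace 𝒪[K] := hc
  have : (Valued.v : Valuation K NNReal).IsNontrivial := by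
    obtain ⟨x, h1⟩ := NormedField.exists_one_lt_norm K
    refine ⟨x, ?_, ?_⟩
    · intro h
      simp at h
      simp [h] at h1
      linarith
    · intro h
      have : ‖x‖ = 1 := congrArg NNReal.toReal h
      linarith
  have : IsDiscreteValuationRing 𝒪[K] := Valued.integer.isDiscreteValuationRing_of_compactSpace
  have : IsNoetherianRing (integers p K) := isNoetherianRing_of_ringEquiv _ e
  have : IsTopologicalRing (integers p K) := inferInstanceAs (IsTopologicalRing (integers p K).toSubring)
  set m := maximalIdeal (integers p K)
  refine { prec' := fun f hf ↦ ?_ }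
  let S n : Set (integers p K) := f n +ᵥ ((m ^ n : Ideal (integers p K)) : Set (integers p K))
  have hS n : S (n + 1) ⊆ S n := by
    apply (Set.vadd_set_subset_vadd_set_iff.mpr (Ideal.pow_le_pow_right n.le_succ)).trans
    simpa [S] using (hf n.le_succ).symm
  have h n : IsClosed (S n) := (IsNoetherianRing.isClosed_ideal (m ^ n)).vadd (f n)
  obtain ⟨L, hL⟩ := (h 0).isCompact.nonempty_iInter_of_sequence_nonempty_isCompact_isClosed S hS
    (by simp [S]) h
  refine ⟨L, fun n ↦ ?_⟩
  obtain ⟨y, hy, rfl⟩ := Set.mem_iInter.mp hL n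
  simpa [SModEq.sub_mem] using hy

end PadicField

section Completion

variable {O : Type*} [CommRing O] (J : Ideal O)
variable (A : Type*) [Ring A] [Algebra O A] {B : Type*} [Ring B] [Algebra O B]

/-- The two-sided ideal `Jⁿ A` of an `O`-algebra `A`. -/
def powIdeal (n : ℕ) : Ideal A := (J ^ n).map (algebraMap O A)

instance isTwoSided_powIdeal (n : ℕ) : (powIdeal J A n).IsTwoSided where
  mul_mem_of_left {a} b ha := by
    refine Submodule.span_induction (p := fun x _ ↦ x * b ∈ powIdeal J A n) ?_ ?_ ?_ ?_ ha
    · rintro _ ⟨r, hr, rfl⟩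
      rw [Algebra.commutes]
      exact Ideal.mul_mem_left _ _ (Ideal.mem_map_of_mem _ hr)
    · simp
    · intro x y _ _ hx hy
      rw [add_mul]
      exact Ideal.add_mem _ hx hy
    · intro c x _ hx
      rw [smul_eq_mul, mul_assoc]
      exact Ideal.mul_mem_left _ _ hx

theorem powIdeal_anti {m n : ℕ} (h : m ≤ n) : powIdeal J A n ≤ powIdeal J A m :=
  Ideal.map_mono (Ideal.pow_le_pow_right h)

/-- The `J`-adic completion `lim A / Jⁿ A` of a (not necessarily commutative) `O`-algebra `A`,
as the algebra of compatible families in `∏ A / Jⁿ A`. -/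
def completion : Subalgebra O (∀ n : ℕ, A ⧸ powIdeal J A n) where
  carrier := {x | ∀ ⦃m n : ℕ⦄ (h : m ≤ n), Ideal.Quotient.factorₐ O (powIdeal_anti J A h) (x n) = x m}
  mul_mem' hx hy m n h := by simp only [Pi.mul_apply, map_mul, hx h, hy h]
  add_mem' hx hy m n h := by simp only [Pi.add_apply, map_add, hx h, hy h]
  algebraMap_mem' r m n h := by simp only [Pi.algebraMap_apply, AlgHom.commutes]

variable {A}

theorem powIdeal_le_comap (f : A →ₐ[O] B) (n : ℕ) :
    powIdeal J A n ≤ (powIdeal J B n).comap f := by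
  refine Ideal.span_le.mpr ?_
  rintro _ ⟨r, hr, rfl⟩
  simp only [SetLike.mem_coe, Ideal.mem_comap, AlgHom.commutes]
  exact Ideal.mem_map_of_mem _ hr

/-- The map `A / Jⁿ A → B / Jⁿ B` induced by an algebra homomorphism `A → B`. -/
def quotientMap (f : A →ₐ[O] B) (n : ℕ) : A ⧸ powIdeal J A n →ₐ[O] B ⧸ powIdeal J B n :=
  Ideal.quotientMapₐ _ f (powIdeal_le_comap J f n)

theorem factor_quotientMap (f : A →ₐ[O] B) {m n : ℕ} (h : m ≤ n) (x : A ⧸ powIdeal J A n) :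
    Ideal.Quotient.factorₐ O (powIdeal_anti J B h) (quotientMap J f n x) =
      quotientMap J f m (Ideal.Quotient.factorₐ O (powIdeal_anti J A h) x) := by
  obtain ⟨a, rfl⟩ := Ideal.Quotient.mk_surjective x
  rfl

/-- The map between completions induced by an algebra homomorphism. -/
def completionMap (f : A →ₐ[O] B) : completion J A →ₐ[O] completion J B where
  toFun x := ⟨fun n ↦ quotientMap J f n (x.1 n), fun m n h ↦ by
    rw [factor_quotientMap J f h, x.2 h]⟩
  map_one' := Subtype.ext <| funext fun n ↦ map_one (quotientMap J f n)
  map_zero' := Subtype.ext <| funext fun n ↦ map_zero (quotientMap J f n)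
  map_mul' x y := Subtype.ext <| funext fun n ↦ map_mul (quotientMap J f n) (x.1 n) (y.1 n)
  map_add' x y := Subtype.ext <| funext fun n ↦ map_add (quotientMap J f n) (x.1 n) (y.1 n)
  commutes' r := Subtype.ext <| funext fun n ↦ (quotientMap J f n).commutes r

theorem powIdeal_self (n : ℕ) : powIdeal J O n = J ^ n := Ideal.map_id _

/-- The composite `completion of A → A / Jⁿ A → O / Jⁿ` for an algebra homomorphism `A → O`. -/
def evalCharacter (f : A →ₐ[O] O) (n : ℕ) : completion J A →ₐ[O] O ⧸ J ^ n :=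
  ((Ideal.Quotient.factorₐ O (powIdeal_self J n).le).comp (quotientMap J f n)).comp
    ((Pi.evalAlgHom O _ n).comp (completion J A).val)

theorem factor_evalCharacter (f : A →ₐ[O] O) {m n : ℕ} (h : m ≤ n) (x : completion J A) :
    Ideal.Quotient.factorPow J h (evalCharacter J f n x) = evalCharacter J f m x := by
  have hx := x.2 h
  obtain ⟨a, ha⟩ := Ideal.Quotient.mk_surjective (x.1 n)
  change Ideal.Quotient.factorPow J h (Ideal.Quotient.factorₐ O (powIdeal_self J n).le
    (quotientMap J f n (x.1 n))) = Ideal.Quotient.factorₐ O (powIdeal_self J m).le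
    (quotientMap J f m (x.1 m))
  rw [← hx, ← ha]
  rfl

/-- The continuous extension to the completion of `A` of an algebra homomorphism `A → O`, where `O`
is `J`-adically complete. -/
def completionCharacter [IsAdicComplete J O] (f : A →ₐ[O] O) : completion J A →ₐ[O] O where
  __ := IsAdicComplete.liftRingHom J (fun n ↦ (evalCharacter J f n : completion J A →+* O ⧸ J ^ n))
    fun h ↦ RingHom.ext (factor_evalCharacter J f h)
  commutes' r := by
    refine IsHausdorff.eq_iff_smodEq (I := J) |>.mpr fun n ↦ ?_
    have h := IsAdicComplete.mk_liftRingHom J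
      (fun n ↦ (evalCharacter J f n : completion J A →+* O ⧸ J ^ n))
      (fun h ↦ RingHom.ext (factor_evalCharacter J f h)) n (algebraMap O _ r)
    rw [SModEq.sub_mem, smul_eq_mul, Ideal.mul_top, ← Ideal.Quotient.eq]
    exact h.trans ((evalCharacter J f n).commutes r)

end Completion

section InducedModule

variable {S A : Type*} [Ring S] [Ring A] (φ : S →+* A) (N : Type*) [AddCommGroup N] [Module S N]

/-- The relations `a φ(s) ⊗ n = a ⊗ s n`; they form a set stable under left multiplication by `A`. -/
def balancedRelations : Submodule A (A ⊗[ℤ] N) :=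
  Submodule.span A {x | ∃ (a : A) (s : S) (n : N), x = (a * φ s) ⊗ₜ[ℤ] n - a ⊗ₜ[ℤ] (s • n)}

/-- The induced left `A`-module `A ⊗_S N`, for a homomorphism `φ : S → A` of (not necessarily
commutative) rings and a left `S`-module `N`; here `A` is a right `S`-module through `φ`. -/
abbrev InducedModule : Type _ := (A ⊗[ℤ] N) ⧸ balancedRelations φ N

end InducedModule

section CharacterModule

variable {S F : Type*} [Ring S] [Field F]

/-- The field `F`, regarded as a left `S`-module through a ring homomorphism `χ : S → F`. -/
def CharacterModule (_χ : S →+* F) : Type _ := F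

variable (χ : S →+* F)

instance : AddCommGroup (CharacterModule χ) := inferInstanceAs (AddCommGroup F)

instance : Module S (CharacterModule χ) := Module.compHom F χ

end CharacterModule

section Dixmier

variable {K : Type*} [Field K] (O : ValuationSubring K)

/-- Restriction of scalars from `K` to `O`. -/
instance lieAlgebraRestrict (g : Type*) [LieRing g] [LieAlgebra K g] : LieAlgebra O g where
  lie_smul r x y := lie_smul (r : K) x y

/-- An `O`-lattice in a `K`-vector space `V`: an `O`-submodule `N` with `⋂ πⁿ N = 0` and
`N ⊗ K = V`. -/
structure IsOLattice {V : Type*} [AddCommGroup V] [Module K V] (N : Submodule O V) : Prop where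
  iInf_eq_bot : (⨅ n : ℕ, (maximalIdeal O) ^ n • N) = ⊥
  span_eq_top : Submodule.span K (N : Set V) = ⊤

/-- The affinoid enveloping algebra with coefficients in `K` of a Lie algebra `L` over `O`: the
tensor product with `K` of the `π`-adic completion of the enveloping algebra of `L`. -/
abbrev AffinoidEnvelope (L : Type*) [LieRing L] [LieAlgebra O L] : Type _ :=
  K ⊗[O] completion (maximalIdeal O) (UniversalEnvelopingAlgebra O L)

/-- The homomorphism of affinoid enveloping algebras induced by a homomorphism of Lie algebras. -/
def affinoidEnvelopeMap {L L' : Type*} [LieRing L] [LieAlgebra O L] [LieRing L'] [LieAlgebra O L']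
    (f : L →ₗ⁅O⁆ L') : AffinoidEnvelope O L →ₐ[K] AffinoidEnvelope O L' :=
  Algebra.TensorProduct.map (AlgHom.id K K) <| completionMap _ <|
    UniversalEnvelopingAlgebra.lift O ((UniversalEnvelopingAlgebra.ι O).comp f)

/-- The homomorphism from the affinoid enveloping algebra of `L` to `K` induced by a character
of `L` with values in `O`. -/
def affinoidEnvelopeCharacter [IsAdicComplete (maximalIdeal O) O]
    {L : Type*} [LieRing L] [LieAlgebra O L] (f : L →ₗ⁅O⁆ O) : AffinoidEnvelope O L →ₐ[K] K :=
  Algebra.TensorProduct.lift (AlgHom.id K K)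
    ((Algebra.ofId O K).comp
      (completionCharacter (maximalIdeal O) (UniversalEnvelopingAlgebra.lift O f)))
    fun _ _ ↦ Commute.all _ _

variable {g : Type*} [LieRing g] [LieAlgebra K g]

/-- A polarisation of `g` at `l`: a solvable subalgebra `b` of `g` such that, for all `u` in `g`,
`l` vanishes on `[u, b]` if and only if `u` lies in `b`. -/
structure IsPolarisation (l : Module.Dual K g) (b : LieSubalgebra K g) : Prop where
  isSolvable : LieAlgebra.IsSolvable b
  forall_lie_eq_zero_iff : ∀ u : g, (∀ w ∈ b, l ⁅u, w⁆ = 0) ↔ u ∈ b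

variable {O}

/-- The intersection of a subalgebra `b` of `g` with an `O`-Lie subalgebra `L` of `g`, as a
subalgebra of `L`. -/
def latticePart (L : LieSubalgebra O g) (b : LieSubalgebra K g) : LieSubalgebra O L where
  carrier := {x | (x : g) ∈ b}
  zero_mem' := b.zero_mem
  add_mem' hx hy := b.add_mem hx hy
  smul_mem' r _ hx := b.smul_mem (r : K) hx
  lie_mem' hx hy := b.lie_mem hx hy

/-- The restriction of `l` to a Lie homomorphism from `b ∩ L` to the commutative Lie algebra `O`,
where `b` is a polarisation at `l` and `l` maps `L` to `O`. -/
def latticeCharacter (L : LieSubalgebra O g) (l : Module.Dual K g) (hl : ∀ x ∈ L, l x ∈ O)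
    (b : LieSubalgebra K g) (hb : IsPolarisation l b) : latticePart L b →ₗ⁅O⁆ O where
  toFun x := ⟨l (x : L), hl _ (x : L).2⟩
  map_add' x y := Subtype.ext (map_add l _ _)
  map_smul' r x := Subtype.ext (map_smul l (r : K) _)
  map_lie' {x y} := Subtype.ext <| by
    have h := (hb.forall_lie_eq_zero_iff ((x : L) : g)).mpr x.2 _ y.2
    simp only [LieRing.of_associative_ring_bracket, mul_comm, sub_self]
    exact h

/-- The affinoid Dixmier module at `l` with respect to the polarisation `b`: the module over the
affinoid enveloping algebra of `L` induced from the one-dimensional module over the affinoid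
enveloping algebra of `b ∩ L` on which `b ∩ L` acts through `l`. -/
abbrev AffinoidDixmierModule [IsAdicComplete (maximalIdeal O) O] (L : LieSubalgebra O g)
    (l : Module.Dual K g) (hl : ∀ x ∈ L, l x ∈ O) (b : LieSubalgebra K g)
    (hb : IsPolarisation l b) : Type _ :=
  InducedModule (affinoidEnvelopeMap O (latticePart L b).incl).toRingHom
    (CharacterModule (affinoidEnvelopeCharacter O (latticeCharacter L l hl b hb)).toRingHom)

end Dixmier

end AffinoidDixmier

end

/-! The trace `B` on `L` of a polarisation is a subalgebra which is its own orthogonal for the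
alternating form `l [u, w]` on `L` (`IsLagrangian`); in particular it is pure in `L`. The Dixmier
module is the cyclic module `A / I` over the affinoid envelope `A`, where `I` is obtained by
inverting `π` in the closure of the left ideal of `U(L)` generated by the `w - l w` with `w` in `B`.
Its annihilator is therefore the set of `y` with `y A ⊆ I`. Writing elements of the completion as
compatible sequences `a n` in `U(L)`, this becomes the condition `Annihilates`, and the heart of the
matter is that this condition does not depend on `B` (`annihilates_iff_of_isLagrangian`).

The basic tool is a decomposition. If `f` is a linear form on `L` vanishing on brackets and `f x =
1`, then `U(L)` is the direct sum of the `x ^ i U(ker f)`. Membership in a left ideal generated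
inside `U(ker f)` is tested on coefficients (`mem_map_envelopingIncl_iff`), so for `B ⊆ ker f`
everything passes to `ker f`, of smaller rank. By nilpotency every proper pure subalgebra lies in
such a kernel (`exists_form_of_ne_top`).

Independence is proved by induction on the rank. If `l` kills all brackets, `L` is the only
Lagrangian subalgebra. Otherwise `exists_isReducing` gives `y` for which `u ↦ l [u, y]` is nonzero
and kills brackets; let `f` be the surjective form with the same kernel. It is enough to move each
Lagrangian `B` into `ker f` without changing the condition. The replacement `B'` is the pure closure
of `(B ∩ ker f) + O y`. Both `B` and `B'` lie in the pure closure `H` of `B + O y`. If `H ≠ L`, the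
induction hypothesis compares them. If `H = L`, then `B` and `B'` have corank one and meet in the
radical of the form. In this Heisenberg situation the condition depends on the radical only
(`annihilates_iff_of_heisenberg`): coefficients become polynomials, right multiplication by `x`
involves `γ d/dX`, and evaluating at `0` yields all Taylor coefficients up to factors `γ ^ k k!`,
which compatible sequences allow one to cancel.

Integrality enters twice. The quotient of `U(L)` by the left ideal is torsion-free
(`mem_of_smul_mem_characterIdeal`), so the closed ideal is saturated and, by successive
approximation, generated by the `w - l w` (`closedIdeal_le_span`); this is why the uncompleted
tensor product is already `A / I`. And `L` is finitely generated, being separated of finite rank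
over a complete discrete valuation ring (`finite_of_isHausdorff`). -/

noncomputable section

attribute [local instance 100] LieRing.ofAssociativeRing

namespace AffinoidDixmier

set_option maxSynthPendingDepth 3

/-! ### Induction in enveloping algebras -/

section Enveloping

variable {O : Type*} [CommRing O] {L : Type*} [LieRing L] [LieAlgebra O L]

/-- Induction principle for the universal enveloping algebra. -/
theorem enveloping_induction {P : UniversalEnvelopingAlgebra O L → Prop}
    (algebraMap : ∀ r, P (algebraMap O _ r)) (ι : ∀ x, P (UniversalEnvelopingAlgebra.ι O x))
    (mul : ∀ u v, P u → P v → P (u * v)) (add : ∀ u v, P u → P v → P (u + v)) (u) : P u := by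
  let S : Subalgebra O (UniversalEnvelopingAlgebra O L) :=
    { carrier := {u | P u}
      mul_mem' := fun {a b} ha hb ↦ mul a b ha hb
      add_mem' := fun {a b} ha hb ↦ add a b ha hb
      algebraMap_mem' := algebraMap }
  let j : L →ₗ⁅O⁆ S :=
    { toFun := fun x ↦ ⟨UniversalEnvelopingAlgebra.ι O x, ι x⟩
      map_add' := fun x y ↦ Subtype.ext (map_add _ x y)
      map_smul' := fun r x ↦ Subtype.ext (map_smul _ r x)
      map_lie' := fun {x y} ↦ Subtype.ext (LieHom.map_lie _ x y) }
  have h : S.val.comp (UniversalEnvelopingAlgebra.lift O j) = AlgHom.id O _ := by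
    apply UniversalEnvelopingAlgebra.hom_ext
    ext x
    change S.val (UniversalEnvelopingAlgebra.lift O j (UniversalEnvelopingAlgebra.ι O x)) =
      UniversalEnvelopingAlgebra.ι O x
    rw [UniversalEnvelopingAlgebra.lift_ι_apply]
    rfl
  have h' := congrArg (fun F ↦ F u) h
  change S.val (UniversalEnvelopingAlgebra.lift O j u) = u at h'
  rw [← h']
  exact (UniversalEnvelopingAlgebra.lift O j u).2

theorem mul_mem_of_ι_mul_mem {N : Type*} [AddCommGroup N] [Module O N]
    (ρ : UniversalEnvelopingAlgebra O L →ₐ[O] Module.End O N) (S : Submodule O N)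
    (h : ∀ x, ∀ s ∈ S, ρ (UniversalEnvelopingAlgebra.ι O x) s ∈ S)
    (u : UniversalEnvelopingAlgebra O L) : ∀ s ∈ S, ρ u s ∈ S := by
  induction u using enveloping_induction with
  | algebraMap r =>
    intro s hs
    rw [AlgHom.commutes]
    exact S.smul_mem r hs
  | ι x => exact h x
  | mul u v hu hv =>
    intro s hs
    rw [map_mul]
    exact hu _ (hv _ hs)
  | add u v hu hv =>
    intro s hs
    rw [map_add]
    exact S.add_mem (hu _ hs) (hv _ hs)

theorem eq_top_of_ι_mul_mem (S : Submodule O (UniversalEnvelopingAlgebra O L)) (h1 : 1 ∈ S)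
    (h : ∀ x, ∀ s ∈ S, UniversalEnvelopingAlgebra.ι O x * s ∈ S) : S = ⊤ := by
  refine eq_top_iff.mpr fun u _ ↦ ?_
  simpa using mul_mem_of_ι_mul_mem (Algebra.lmul O _) S h u 1 h1

end Enveloping

/-! ### Freeness of `U(L)` over the enveloping algebra of a codimension-one ideal -/

section Ore

variable {O : Type*} [CommRing O] {L : Type*} [LieRing L] [LieAlgebra O L]

/-- The kernel of a linear form vanishing on brackets, as a subalgebra. -/
def kerSubalgebra (f : L →ₗ[O] O) (hf : ∀ x y : L, f ⁅x, y⁆ = 0) : LieSubalgebra O L :=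
  { LinearMap.ker f with lie_mem' := fun {x y} _ _ ↦ hf x y }

variable {f : L →ₗ[O] O} {hf : ∀ x y : L, f ⁅x, y⁆ = 0}

theorem mem_kerSubalgebra {x : L} : x ∈ kerSubalgebra f hf ↔ f x = 0 := Iff.rfl

variable (f hf)

/-- The bracket with `x`, as an endomorphism of the kernel of a linear form. -/
def adKer (x : L) : kerSubalgebra f hf →ₗ[O] kerSubalgebra f hf where
  toFun m := ⟨⁅x, (m : L)⁆, hf _ _⟩
  map_add' m n := Subtype.ext (lie_add x (m : L) n)
  map_smul' r m := Subtype.ext (lie_smul r x (m : L))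

theorem adKer_lie (x : L) (m n : kerSubalgebra f hf) :
    adKer f hf x ⁅m, n⁆ = ⁅adKer f hf x m, n⁆ + ⁅m, adKer f hf x n⁆ :=
  Subtype.ext (leibniz_lie x (m : L) (n : L))

variable {f hf}

section PowerModule

variable (O) (M : Type*) [LieRing M] [LieAlgebra O M]

/-- The free right module on the powers of an indeterminate over an enveloping algebra. -/
abbrev PowerModule : Type _ := ℕ →₀ UniversalEnvelopingAlgebra O M

/-- Multiplication by the indeterminate. -/
def powerShift : Module.End O (PowerModule O M) := Finsupp.lmapDomain _ O Nat.succ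

@[simp]
theorem powerShift_single (i : ℕ) (r : UniversalEnvelopingAlgebra O M) :
    powerShift O M (Finsupp.single i r) = Finsupp.single (i + 1) r := by
  simp [powerShift]

variable {O M}

/-- The action below is known on degree `0` and through its commutation with the shift, so induction
runs over these rather than over basis vectors. -/
theorem powerModule_induction {P : PowerModule O M → Prop} (zero : P 0)
    (add : ∀ n n', P n → P n' → P (n + n')) (single : ∀ r, P (Finsupp.single 0 r))
    (shift : ∀ n, P n → P (powerShift O M n)) (n) : P n := by
  induction n using Finsupp.induction_linear with
  | zero => exact zero
  | add n n' h h' => exact add n n' h h'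
  | single i r =>
    induction i with
    | zero => exact single r
    | succ i hi => exact powerShift_single O M i r ▸ shift _ hi

variable (d : M →ₗ[O] M)

/-- The action of `m` on the part of degree `i` of the module of powers of an indeterminate
which acts on `M` by `d`. -/
def powerActionAux : ℕ → M →ₗ[O] UniversalEnvelopingAlgebra O M →ₗ[O] PowerModule O M
  | 0 => ((LinearMap.mul O _).compr₂ (Finsupp.lsingle 0)).comp
      (UniversalEnvelopingAlgebra.ι O : M →ₗ⁅O⁆ _).toLinearMap
  | i + 1 => (powerActionAux i).compr₂ (powerShift O M) - (powerActionAux i).comp d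

/-- The action of `M` on the module of powers of an indeterminate which acts on `M` by `d`. -/
def powerAction : M →ₗ[O] Module.End O (PowerModule O M) :=
  (Finsupp.lsum O).toLinearMap.comp (LinearMap.pi (powerActionAux d))

theorem powerAction_zero (m : M) (r : UniversalEnvelopingAlgebra O M) :
    powerAction d m (Finsupp.single 0 r) =
      Finsupp.single 0 (UniversalEnvelopingAlgebra.ι O m * r) := by
  change Finsupp.lsum O _ _ = _
  rw [Finsupp.lsum_single]
  rfl

/-- This is the relation `m x = x m - [x, m]`, with `d` in the role of `[x, ·]`. -/
theorem powerAction_shift (m : M) (n : PowerModule O M) :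
    powerAction d m (powerShift O M n) =
      powerShift O M (powerAction d m n) - powerAction d (d m) n := by
  induction n using Finsupp.induction_linear with
  | zero => simp
  | add n n' h h' => simp only [map_add, h, h']; abel
  | single i r =>
    rw [powerShift_single]
    change Finsupp.lsum O _ _ = powerShift O M (Finsupp.lsum O _ _) - Finsupp.lsum O _ _
    simp only [Finsupp.lsum_single]
    rfl

/-- Moving past the shift replaces `m` or `m'` by its image under `d`, so the induction must keep
both general; the terms match exactly because `d` is a derivation. -/
theorem powerAction_lie (hd : ∀ m m', d ⁅m, m'⁆ = ⁅d m, m'⁆ + ⁅m, d m'⁆) (m m' : M)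
    (n : PowerModule O M) : powerAction d ⁅m, m'⁆ n =
      powerAction d m (powerAction d m' n) - powerAction d m' (powerAction d m n) := by
  induction n using powerModule_induction generalizing m m' with
  | zero => simp
  | add n n' h h' => simp only [map_add, h, h']; abel
  | single r =>
    simp only [powerAction_zero, LieHom.map_lie, LieRing.of_associative_ring_bracket, sub_mul,
      mul_assoc, Finsupp.single_sub]
  | shift n h =>
    simp only [powerAction_shift, map_sub, hd, map_add, LinearMap.add_apply, h]
    abel

theorem powerShift_mapRange (b : UniversalEnvelopingAlgebra O M) (n : PowerModule O M) :
    powerShift O M (Finsupp.mapRange.linearMap (LinearMap.mulRight O b) n) =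
      Finsupp.mapRange.linearMap (LinearMap.mulRight O b) (powerShift O M n) := by
  induction n using Finsupp.induction_linear with
  | zero => simp
  | add n n' h h' => simp only [map_add, h, h']
  | single i r => simp only [Finsupp.mapRange.linearMap_apply, Finsupp.mapRange_single,
      powerShift_single]

theorem powerAction_mapRange (b : UniversalEnvelopingAlgebra O M) (m : M) (n : PowerModule O M) :
    powerAction d m (Finsupp.mapRange.linearMap (LinearMap.mulRight O b) n) =
      Finsupp.mapRange.linearMap (LinearMap.mulRight O b) (powerAction d m n) := by
  induction n using powerModule_induction generalizing m with
  | zero => simp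
  | add n n' h h' => simp only [map_add, h, h']
  | single r =>
    simp only [Finsupp.mapRange.linearMap_apply, Finsupp.mapRange_single, powerAction_zero,
      LinearMap.mulRight_apply, mul_assoc]
  | shift n h => simp only [← powerShift_mapRange, powerAction_shift, h, map_sub]

end PowerModule

variable {x : L} (hx : f x = 1)

/-- The component in the kernel of `f` along `x`. -/
def kerPart (u : L) : kerSubalgebra f hf :=
  ⟨u - f u • x, by simp [mem_kerSubalgebra, hx]⟩

/-- The action of `L` on the module of powers of `x`. -/
def powerRep : L →ₗ⁅O⁆ Module.End O (PowerModule O (kerSubalgebra f hf)) where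
  toFun u := f u • powerShift O (kerSubalgebra f hf) + powerAction (adKer f hf x) (kerPart hx u)
  map_add' u v := by
    have : (kerPart hx (u + v) : kerSubalgebra f hf) = kerPart hx u + kerPart hx v :=
      Subtype.ext (by simp only [kerPart, map_add, AddMemClass.mk_add_mk]; module)
    rw [this, map_add, map_add]
    module
  map_smul' r u := by
    have : (kerPart hx (r • u) : kerSubalgebra f hf) = r • kerPart hx u :=
      Subtype.ext (by simp only [kerPart, map_smul, SetLike.mk_smul_mk, smul_eq_mul]; module)
    rw [this, map_smul, map_smul, RingHom.id_apply, smul_eq_mul]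
    module
  map_lie' {u v} := by
    -- Expand the bracket of `u = f u • x + u'` and `v = f v • x + v'`; it lies in the kernel, so it
    -- has no component along `x`.
    have : (kerPart hx ⁅u, v⁆ : kerSubalgebra f hf) =
        f u • adKer f hf x (kerPart hx v) - f v • adKer f hf x (kerPart hx u) +
          ⁅kerPart hx u, kerPart hx v⁆ := by
      apply Subtype.ext
      simp only [kerPart, hf, AddMemClass.coe_add, AddSubgroupClass.coe_sub, SetLike.val_smul,
        LieSubalgebra.coe_bracket, adKer, LinearMap.coe_mk, AddHom.coe_mk, lie_sub, sub_lie,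
        lie_smul, smul_lie, lie_self, ← lie_skew u x, smul_sub, smul_neg]
      module
    refine LinearMap.ext fun n ↦ ?_
    rw [this, hf, LieRing.of_associative_ring_bracket]
    simp only [map_add, map_sub, map_smul, LinearMap.add_apply, LinearMap.sub_apply,
      LinearMap.smul_apply, powerAction_lie _ (adKer_lie f hf x), Module.End.mul_apply, powerAction_shift]
    module

/-- The coefficients of an element of the enveloping algebra of `L` along the powers of `x`. -/
def coefficients : UniversalEnvelopingAlgebra O L →ₗ[O] PowerModule O (kerSubalgebra f hf) :=
  (LinearMap.applyₗ (Finsupp.single 0 1)).comp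
    (UniversalEnvelopingAlgebra.lift O (powerRep (hf := hf) hx)).toLinearMap

/-- The homomorphism of enveloping algebras induced by the inclusion of a subalgebra. -/
abbrev envelopingIncl (M : LieSubalgebra O L) :
    UniversalEnvelopingAlgebra O M →ₐ[O] UniversalEnvelopingAlgebra O L :=
  UniversalEnvelopingAlgebra.lift O ((UniversalEnvelopingAlgebra.ι O).comp M.incl)

theorem envelopingIncl_ι (M : LieSubalgebra O L) (m : M) :
    envelopingIncl M (UniversalEnvelopingAlgebra.ι O m) = UniversalEnvelopingAlgebra.ι O (m : L) :=
  UniversalEnvelopingAlgebra.lift_ι_apply O _ m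

/-- The action uses only left multiplications and shifts, so it commutes with right multiplication.
This makes `coefficients` right linear over `U(ker f)`. -/
theorem lift_powerRep_mapRange (u : UniversalEnvelopingAlgebra O L) (n : PowerModule O (kerSubalgebra f hf))
    (b : UniversalEnvelopingAlgebra O (kerSubalgebra f hf)) :
    UniversalEnvelopingAlgebra.lift O (powerRep hx) u
        (Finsupp.mapRange.linearMap (LinearMap.mulRight O b) n) =
      Finsupp.mapRange.linearMap (LinearMap.mulRight O b)
        (UniversalEnvelopingAlgebra.lift O (powerRep hx) u n) := by
  induction u using enveloping_induction generalizing n with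
  | algebraMap r => simp only [AlgHom.commutes, Module.algebraMap_end_apply, map_smul]
  | ι y =>
    rw [UniversalEnvelopingAlgebra.lift_ι_apply]
    change (f y • powerShift O (kerSubalgebra f hf) + powerAction (adKer f hf x) (kerPart hx y)) _ =
      Finsupp.mapRange.linearMap _ ((f y • powerShift O (kerSubalgebra f hf) + powerAction (adKer f hf x) (kerPart hx y)) n)
    simp only [LinearMap.add_apply, LinearMap.smul_apply, powerShift_mapRange, powerAction_mapRange,
      map_add, map_smul]
  | mul u v hu hv => simp only [map_mul, Module.End.mul_apply, hu, hv]
  | add u v hu hv => simp only [map_add, LinearMap.add_apply, hu, hv]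

theorem lift_powerRep_envelopingIncl (a b : UniversalEnvelopingAlgebra O (kerSubalgebra f hf)) :
    UniversalEnvelopingAlgebra.lift O (powerRep hx) (envelopingIncl _ a) (Finsupp.single 0 b) =
      Finsupp.single 0 (a * b) := by
  induction a using enveloping_induction generalizing b with
  | algebraMap r =>
    simp only [AlgHom.commutes, Module.algebraMap_end_apply, Finsupp.smul_single, Algebra.smul_def]
  | ι m =>
    rw [envelopingIncl_ι, UniversalEnvelopingAlgebra.lift_ι_apply]
    change (f m • powerShift O (kerSubalgebra f hf) + powerAction (adKer f hf x) (kerPart hx m)) _ = _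
    have h0 : f m = 0 := m.2
    have : kerPart hx m = m := Subtype.ext (by simp [kerPart, h0])
    rw [h0, this, zero_smul, zero_add, powerAction_zero]
  | mul u v hu hv => simp only [map_mul, Module.End.mul_apply, hu, hv, mul_assoc]
  | add u v hu hv => simp only [map_add, LinearMap.add_apply, hu, hv, add_mul, Finsupp.single_add]

theorem coefficients_mul (u : UniversalEnvelopingAlgebra O L)
    (b : UniversalEnvelopingAlgebra O (kerSubalgebra f hf)) (i : ℕ) :
    coefficients hx (u * envelopingIncl _ b) i = coefficients hx u i * b := by
  have h := lift_powerRep_mapRange hx u (Finsupp.single 0 1) b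
  change UniversalEnvelopingAlgebra.lift O (powerRep hx) (u * envelopingIncl _ b)
    (Finsupp.single 0 1) i = UniversalEnvelopingAlgebra.lift O (powerRep hx) u
    (Finsupp.single 0 1) i * b
  rw [map_mul, Module.End.mul_apply, lift_powerRep_envelopingIncl, mul_one]
  simp only [Finsupp.mapRange.linearMap_apply, Finsupp.mapRange_single, LinearMap.mulRight_apply,
    one_mul] at h
  rw [h]
  simp

theorem coefficients_pow_mul (k : ℕ) (b : UniversalEnvelopingAlgebra O (kerSubalgebra f hf)) :
    coefficients hx (UniversalEnvelopingAlgebra.ι O x ^ k * envelopingIncl _ b) =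
      Finsupp.single k b := by
  have hX n : UniversalEnvelopingAlgebra.lift O (powerRep (hf := hf) hx)
      (UniversalEnvelopingAlgebra.ι O x) n = powerShift O (kerSubalgebra f hf) n := by
    rw [UniversalEnvelopingAlgebra.lift_ι_apply]
    change (f x • powerShift O (kerSubalgebra f hf) + powerAction (adKer f hf x) (kerPart hx x)) _ = _
    have : (kerPart hx x : kerSubalgebra f hf) = 0 := Subtype.ext (by simp [kerPart, hx])
    rw [hx, this, map_zero, add_zero, one_smul]
  change UniversalEnvelopingAlgebra.lift O (powerRep hx) _ (Finsupp.single 0 1) = _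
  rw [map_mul, Module.End.mul_apply, lift_powerRep_envelopingIncl, mul_one]
  induction k with
  | zero => simp
  | succ k hk => rw [pow_succ', map_mul, Module.End.mul_apply, hk, hX, powerShift_single]

/-- The element of the enveloping algebra of `L` with given coefficients. -/
def ofCoefficients : PowerModule O (kerSubalgebra f hf) →ₗ[O] UniversalEnvelopingAlgebra O L :=
  Finsupp.lsum O fun i ↦ (LinearMap.mulLeft O (UniversalEnvelopingAlgebra.ι O x ^ i)).comp
    (envelopingIncl (kerSubalgebra f hf)).toLinearMap

theorem ofCoefficients_single (i : ℕ) (b : UniversalEnvelopingAlgebra O (kerSubalgebra f hf)) :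
    ofCoefficients (x := x) (Finsupp.single i b) =
      UniversalEnvelopingAlgebra.ι O x ^ i * envelopingIncl _ b := by
  rw [ofCoefficients, Finsupp.lsum_single]
  rfl

/-- The sum of the `x ^ i U(ker f)` contains `1` and is stable under left multiplication by `x` and
by `ker f`, which together span `L`. -/
theorem range_ofCoefficients (hx : f x = 1) :
    LinearMap.range (ofCoefficients (f := f) (hf := hf) (x := x)) = ⊤ := by
  have hX n : UniversalEnvelopingAlgebra.ι O x * ofCoefficients (x := x) n =
      ofCoefficients (x := x) (powerShift O (kerSubalgebra f hf) n) := by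
    induction n using Finsupp.induction_linear with
    | zero => simp
    | add n n' h h' => simp only [map_add, mul_add, h, h']
    | single i b =>
      rw [powerShift_single, ofCoefficients_single, ofCoefficients_single, ← mul_assoc, pow_succ']
  have hm (m : kerSubalgebra f hf) n : UniversalEnvelopingAlgebra.ι O (m : L) *
      ofCoefficients (x := x) n = ofCoefficients (x := x) (powerAction (adKer f hf x) m n) := by
    induction n using powerModule_induction generalizing m with
    | zero => simp
    | add n n' h h' => simp only [map_add, mul_add, h, h']
    | single b =>
      rw [powerAction_zero, ofCoefficients_single, ofCoefficients_single, map_mul,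
        envelopingIncl_ι, pow_zero, one_mul, one_mul]
    | shift n h =>
      have h1 : UniversalEnvelopingAlgebra.ι O (adKer f hf x m : L) =
          UniversalEnvelopingAlgebra.ι O x * UniversalEnvelopingAlgebra.ι O (m : L) -
          UniversalEnvelopingAlgebra.ι O (m : L) * UniversalEnvelopingAlgebra.ι O x := by
        rw [← LieRing.of_associative_ring_bracket, ← LieHom.map_lie]
        rfl
      rw [← hX, powerAction_shift, map_sub, ← hX, ← h, ← h, h1]
      noncomm_ring
  refine eq_top_of_ι_mul_mem _ ⟨Finsupp.single 0 1, ?_⟩ ?_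
  · rw [ofCoefficients_single, pow_zero, one_mul, map_one]
  · rintro y _ ⟨n, rfl⟩
    have hy : y = f y • x + (kerPart (hf := hf) hx y : L) := by simp [kerPart]
    rw [hy, map_add, map_smul, add_mul, smul_mul_assoc, hX, hm, ← map_smul, ← map_add]
    exact ⟨_, rfl⟩

/-- Together with `coefficients_pow_mul` this makes `U(L)` the direct sum of the `x ^ i U(ker f)`,
without the Poincaré–Birkhoff–Witt theorem. -/
theorem ofCoefficients_coefficients (u : UniversalEnvelopingAlgebra O L) :
    ofCoefficients (x := x) (coefficients (hf := hf) hx u) = u := by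
  obtain ⟨n, rfl⟩ : u ∈ LinearMap.range (ofCoefficients (f := f) (hf := hf) (x := x)) :=
    range_ofCoefficients hx ▸ Submodule.mem_top
  induction n using Finsupp.induction_linear with
  | zero => simp
  | add n n' h h' => simp only [map_add, h, h']
  | single i b => rw [ofCoefficients_single, coefficients_pow_mul, ofCoefficients_single]

end Ore

/-! ### Pure submodules and surjective linear forms -/

section Isolator

variable {O : Type*} [CommRing O] [IsDomain O] {M : Type*} [AddCommGroup M] [Module O M]

/-- The submodule of the elements having a nonzero multiple in `N`. -/
def isolator (N : Submodule O M) : Submodule O M where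
  carrier := {u | ∃ t : O, t ≠ 0 ∧ t • u ∈ N}
  zero_mem' := ⟨1, one_ne_zero, by simp⟩
  add_mem' := by
    rintro u v ⟨t, ht, hu⟩ ⟨s, hs, hv⟩
    refine ⟨t * s, mul_ne_zero ht hs, ?_⟩
    rw [smul_add, mul_comm t s, mul_smul, mul_comm s t, mul_smul]
    exact N.add_mem (N.smul_mem s hu) (N.smul_mem t hv)
  smul_mem' := by
    rintro r u ⟨t, ht, hu⟩
    exact ⟨t, ht, smul_comm t r u ▸ N.smul_mem r hu⟩

theorem le_isolator (N : Submodule O M) : N ≤ isolator N :=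
  fun u hu ↦ ⟨1, one_ne_zero, by simpa using hu⟩

theorem isolator_mono {N N' : Submodule O M} (h : N ≤ N') : isolator N ≤ isolator N' :=
  fun _ ⟨t, ht, hu⟩ ↦ ⟨t, ht, h hu⟩

theorem isolator_isolator (N : Submodule O M) : isolator (isolator N) = isolator N := by
  refine le_antisymm ?_ (le_isolator _)
  rintro u ⟨t, ht, s, hs, hu⟩
  exact ⟨s * t, mul_ne_zero hs ht, by rwa [mul_smul]⟩

theorem isolator_le_of_le_isolator {N N' : Submodule O M} (h : N ≤ isolator N') :
    isolator N ≤ isolator N' :=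
  (isolator_mono h).trans (isolator_isolator N').le

/-- A submodule of infinite index is killed by a surjective linear form. -/
theorem exists_form_eq_one [IsPrincipalIdealRing O] [Module.Finite O M] {N : Submodule O M}
    (h : isolator N ≠ ⊤) : ∃ f : M →ₗ[O] O, (∀ u ∈ N, f u = 0) ∧ ∃ x, f x = 1 := by
  let Q := (M ⧸ N) ⧸ Submodule.torsion O (M ⧸ N)
  let q : M →ₗ[O] Q := (Submodule.mkQ _).comp N.mkQ
  have hq : Function.Surjective q := (Submodule.mkQ_surjective _).comp N.mkQ_surjective
  obtain ⟨u, hu⟩ : ∃ u, u ∉ isolator N := by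
    by_contra! h'
    exact h (eq_top_iff.mpr fun u _ ↦ h' u)
  have hn : q u ≠ 0 := by
    intro h0
    have h1 : N.mkQ u ∈ Submodule.torsion O (M ⧸ N) := by
      rw [← Submodule.ker_mkQ (Submodule.torsion O (M ⧸ N))]
      exact h0
    obtain ⟨t, ht⟩ := (Submodule.mem_torsion_iff _).mp h1
    refine hu ⟨t, nonZeroDivisors.ne_zero t.2, ?_⟩
    rw [← Submodule.ker_mkQ N, LinearMap.mem_ker, map_smul]
    exact ht
  -- `Q` is finite and torsion-free over a principal ideal domain, hence free; being nonzero it has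
  -- a basis vector, and a coordinate takes the value `1` there.
  let b := Module.Free.chooseBasis O Q
  obtain ⟨i, -⟩ : ∃ i, b.repr (q u) i ≠ 0 := by
    by_contra! h'
    exact hn (b.repr.map_eq_zero_iff.mp (Finsupp.ext h'))
  refine ⟨(b.coord i).comp q, fun v hv ↦ ?_, ?_⟩
  · have : q v = 0 := by
      change Submodule.mkQ _ (N.mkQ v) = 0
      rw [show N.mkQ v = 0 from (Submodule.Quotient.mk_eq_zero N).mpr hv, map_zero]
    rw [LinearMap.comp_apply, this, map_zero]
  · obtain ⟨x, hx⟩ := hq (b i)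
    exact ⟨x, by rw [LinearMap.comp_apply, hx]; simp⟩

theorem isolator_ker (f : M →ₗ[O] O) : isolator (LinearMap.ker f) = LinearMap.ker f := by
  refine le_antisymm ?_ (le_isolator _)
  rintro u ⟨t, ht, hu⟩
  rw [LinearMap.mem_ker, map_smul, smul_eq_mul] at hu
  exact (mul_eq_zero.mp hu).resolve_left ht

/-- A nonzero linear form has the kernel of a surjective one. -/
theorem exists_form_ker_eq [IsPrincipalIdealRing O] [Module.Finite O M] {f : M →ₗ[O] O}
    (h : f ≠ 0) : ∃ f' : M →ₗ[O] O, (∀ u, f' u = 0 ↔ f u = 0) ∧ ∃ x, f' x = 1 := by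
  obtain ⟨f', h1, x, hx⟩ := exists_form_eq_one (N := LinearMap.ker f) (by
    rw [isolator_ker, Ne, LinearMap.ker_eq_top]
    exact h)
  refine ⟨f', fun u ↦ ⟨fun hu ↦ ?_, h1 u⟩, x, hx⟩
  -- This combination lies in `ker f`, so `f'` kills it; as `f' x = 1`, vanishing of `f' u` forces
  -- `f u = 0`.
  have h2 := h1 (f u • x - f x • u) (by simp [mul_comm])
  simpa [hu, hx] using h2

theorem finrank_ker_lt [IsPrincipalIdealRing O] [Module.Finite O M] [Module.IsTorsionFree O M]
    {f : M →ₗ[O] O} {x : M} (hx : f x = 1) :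
    Module.finrank O (LinearMap.ker f) < Module.finrank O M := by
  have hs : LinearMap.range f = ⊤ := LinearMap.range_eq_top.mpr fun r ↦ ⟨r • x, by simp [hx]⟩
  have h := Submodule.finrank_quotient_add_finrank (LinearMap.ker f)
  rw [(f.quotKerEquivRange).finrank_eq, hs, finrank_top, Module.finrank_self] at h
  omega

end Isolator

/-! ### Proper pure subalgebras of nilpotent Lie algebras -/

section Nilpotent

variable {O : Type*} [CommRing O] [IsDomain O] {L : Type*} [LieRing L] [LieAlgebra O L]

/-- A subalgebra of a nilpotent Lie algebra which together with the brackets has finite index has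
itself finite index. -/
theorem isolator_eq_top_of_sup [LieRing.IsNilpotent L] {B : LieSubalgebra O L}
    (h : isolator (B.toSubmodule ⊔ Submodule.span O {z | ∃ x y : L, z = ⁅x, y⁆}) = ⊤) :
    isolator B.toSubmodule = ⊤ := by
  obtain ⟨k, hk⟩ := LieModule.IsNilpotent.nilpotent O L L
  -- Descend the lower central series: if multiples of `x` and `y` lie in `B + C i`, then a multiple
  -- of `[x, y]` lies in `B + C (i + 1)`.
  suffices H : ∀ i, isolator (B.toSubmodule ⊔
      (LieModule.lowerCentralSeries O L L i).toSubmodule) = ⊤ by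
    have := H k
    rwa [hk, LieSubmodule.bot_toSubmodule, sup_bot_eq] at this
  intro i
  induction i with
  | zero =>
    rw [LieModule.lowerCentralSeries_zero, LieSubmodule.top_toSubmodule, sup_top_eq]
    exact top_le_iff.mp (le_isolator _)
  | succ i ih =>
    rw [eq_top_iff, ← h]
    apply isolator_le_of_le_isolator
    refine sup_le (le_sup_left.trans (le_isolator _)) (Submodule.span_le.mpr ?_)
    rintro _ ⟨x, y, rfl⟩
    obtain ⟨t, ht, hx⟩ : x ∈ isolator _ := ih ▸ Submodule.mem_top
    obtain ⟨s, hs, hy⟩ : y ∈ isolator _ := ih ▸ Submodule.mem_top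
    obtain ⟨b, hb, c, hc, hx⟩ := Submodule.mem_sup.mp hx
    obtain ⟨b', hb', c', hc', hy⟩ := Submodule.mem_sup.mp hy
    refine ⟨t * s, mul_ne_zero ht hs, ?_⟩
    have e : (t * s) • ⁅x, y⁆ = ⁅b, b'⁆ + (⁅b, c'⁆ - ⁅b', c⁆ + ⁅c, c'⁆) := by
      rw [mul_smul, ← lie_smul, ← smul_lie, ← hx, ← hy, add_lie, lie_add, lie_add,
        ← lie_skew b' c]
      abel
    have hl (u v : L) (hv : v ∈ LieModule.lowerCentralSeries O L L i) :
        ⁅u, v⁆ ∈ LieModule.lowerCentralSeries O L L (i + 1) := by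
      rw [LieModule.lowerCentralSeries_succ]
      exact LieSubmodule.lie_mem_lie (LieSubmodule.mem_top u) hv
    rw [e]
    refine Submodule.add_mem_sup (B.lie_mem hb hb') ?_
    exact add_mem (sub_mem (hl _ _ hc') (hl _ _ hc)) (hl _ _ hc')

/-- If no such form existed, `B + [L, L]` would have torsion quotient, hence so would `B` by
nilpotency, and purity would give `B = L`. The kernel of the form is the ideal to which the
inductions on rank descend. -/
theorem exists_form_of_ne_top [IsPrincipalIdealRing O] [Module.Finite O L]
    [LieRing.IsNilpotent L] {B : LieSubalgebra O L}
    (hB : isolator B.toSubmodule = B.toSubmodule) (hB' : B ≠ ⊤) :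
    ∃ f : L →ₗ[O] O, (∀ x y : L, f ⁅x, y⁆ = 0) ∧ (∀ u ∈ B, f u = 0) ∧ ∃ x, f x = 1 := by
  obtain ⟨f, hf, hx⟩ := exists_form_eq_one (M := L)
    (N := B.toSubmodule ⊔ Submodule.span O {z | ∃ x y : L, z = ⁅x, y⁆}) fun h ↦ hB' (by
      have := isolator_eq_top_of_sup h
      rw [hB] at this
      exact SetLike.ext fun u ↦ ⟨fun _ ↦ LieSubalgebra.mem_top u, fun _ ↦ by
        rw [← LieSubalgebra.mem_toSubmodule, this]; exact Submodule.mem_top⟩)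
  exact ⟨f, fun x y ↦ hf _ (Submodule.mem_sup_right (Submodule.subset_span ⟨x, y, rfl⟩)),
    fun u hu ↦ hf _ (Submodule.mem_sup_left hu), hx⟩

end Nilpotent

/-! ### Left ideals attached to characters of subalgebras -/

section CharacterIdeal

variable {O : Type*} [CommRing O] {L : Type*} [LieRing L] [LieAlgebra O L]

/-- The left ideal of the enveloping algebra of `L` generated by the elements `w - l w` with `w` in
`B`. -/
def characterIdeal (l : L →ₗ[O] O) (B : LieSubalgebra O L) :
    Ideal (UniversalEnvelopingAlgebra O L) :=
  Ideal.span ((fun w ↦ UniversalEnvelopingAlgebra.ι O w - algebraMap O _ (l w)) '' B)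

/-- The left ideal generated by the elements `w - l w` with `w` in `B` and by `Jⁿ`. -/
def approxIdeal (J : Ideal O) (l : L →ₗ[O] O) (B : LieSubalgebra O L) (n : ℕ) :
    Ideal (UniversalEnvelopingAlgebra O L) :=
  characterIdeal l B ⊔ powIdeal J _ n

variable {l : L →ₗ[O] O} {B : LieSubalgebra O L} {J : Ideal O}

theorem sub_mem_characterIdeal {w : L} (hw : w ∈ B) :
    UniversalEnvelopingAlgebra.ι O w - algebraMap O _ (l w) ∈ characterIdeal l B :=
  Ideal.subset_span ⟨w, hw, rfl⟩

theorem characterIdeal_mono {B' : LieSubalgebra O L} (h : B ≤ B') :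
    characterIdeal l B ≤ characterIdeal l B' :=
  Ideal.span_mono (Set.image_mono h)

theorem approxIdeal_mono {B' : LieSubalgebra O L} (h : B ≤ B') (n : ℕ) :
    approxIdeal J l B n ≤ approxIdeal J l B' n :=
  sup_le_sup_right (characterIdeal_mono h) _

theorem map_characterIdeal {M : LieSubalgebra O L} (h : B ≤ M) :
    (characterIdeal (l.comp M.toSubmodule.subtype) (B.comap M.incl)).map (envelopingIncl M) =
      characterIdeal l B := by
  rw [characterIdeal, Ideal.map_span, characterIdeal, ← Set.image_comp]
  congr 1
  ext z
  constructor
  · rintro ⟨w, hw, rfl⟩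
    refine ⟨w, hw, ?_⟩
    simp only [Function.comp_apply, map_sub, envelopingIncl_ι, AlgHom.commutes]
    rfl
  · rintro ⟨w, hw, rfl⟩
    refine ⟨⟨w, h hw⟩, hw, ?_⟩
    simp only [Function.comp_apply, map_sub, envelopingIncl_ι, AlgHom.commutes]
    rfl

theorem map_approxIdeal {M : LieSubalgebra O L} (h : B ≤ M) (n : ℕ) :
    (approxIdeal J (l.comp M.toSubmodule.subtype) (B.comap M.incl) n).map (envelopingIncl M) =
      approxIdeal J l B n := by
  rw [approxIdeal, Ideal.map_sup, map_characterIdeal h, powIdeal, approxIdeal, powIdeal]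
  congr 1
  have := Ideal.map_map (I := J ^ n) (algebraMap O (UniversalEnvelopingAlgebra O M))
    (envelopingIncl M : UniversalEnvelopingAlgebra O M →+* UniversalEnvelopingAlgebra O L)
  rw [AlgHom.comp_algebraMap] at this
  exact this

/-- By freeness, the left ideal generated by `I` is the direct sum of the `x ^ i I`. -/
theorem mem_map_envelopingIncl_iff {f : L →ₗ[O] O} {hf : ∀ x y : L, f ⁅x, y⁆ = 0} {x : L}
    (hx : f x = 1) {I : Ideal (UniversalEnvelopingAlgebra O (kerSubalgebra f hf))}
    {u : UniversalEnvelopingAlgebra O L} :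
    u ∈ I.map (envelopingIncl (kerSubalgebra f hf)) ↔ ∀ i, coefficients hx u i ∈ I := by
  constructor
  · intro hu i
    suffices H : ∀ v i, coefficients (hf := hf) hx (v * u) i ∈ I by simpa using H 1 i
    refine Submodule.span_induction (p := fun u _ ↦ ∀ v i, coefficients hx (v * u) i ∈ I)
      ?_ ?_ ?_ ?_ hu
    · rintro _ ⟨b, hb, rfl⟩ v i
      rw [coefficients_mul]
      exact I.mul_mem_left _ hb
    · simp
    · intro a b _ _ ha hb v i
      rw [mul_add, map_add]
      exact I.add_mem (ha v i) (hb v i)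
    · intro c a _ ha v i
      rw [smul_eq_mul, ← mul_assoc]
      exact ha _ i
  · intro h
    rw [← ofCoefficients_coefficients (hf := hf) hx u]
    rw [ofCoefficients, Finsupp.lsum_apply]
    refine Submodule.sum_mem _ fun i _ ↦ ?_
    exact Ideal.mul_mem_left _ (UniversalEnvelopingAlgebra.ι O x ^ i)
      (Ideal.mem_map_of_mem (envelopingIncl (kerSubalgebra f hf)) (h i))

end CharacterIdeal

/-! ### Torsion-freeness of the cyclic modules -/

section Torsion

variable {O : Type*} [CommRing O] {L : Type*} [LieRing L] [LieAlgebra O L]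

/-- An algebra homomorphism which sends every `x` to `l x` sends every element of the enveloping
algebra to its class modulo the corresponding left ideal. -/
theorem sub_algebraMap_mem_characterIdeal (l : L →ₗ[O] O)
    (χ : UniversalEnvelopingAlgebra O L →ₐ[O] O)
    (hχ : ∀ x, χ (UniversalEnvelopingAlgebra.ι O x) = l x) (u : UniversalEnvelopingAlgebra O L) :
    u - algebraMap O _ (χ u) ∈ characterIdeal l ⊤ := by
  induction u using enveloping_induction with
  | algebraMap r => simp
  | ι x =>
    rw [hχ]
    exact sub_mem_characterIdeal (LieSubalgebra.mem_top x)
  | mul u v hu hv =>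
    have e : u * v - algebraMap O _ (χ (u * v)) = u * (v - algebraMap O _ (χ v)) +
        algebraMap O _ (χ v) * (u - algebraMap O _ (χ u)) := by
      rw [mul_sub, mul_sub, ← Algebra.commutes, map_mul, map_mul,
        Algebra.commutes (χ u) (algebraMap O (UniversalEnvelopingAlgebra O L) (χ v))]
      abel
    rw [e]
    exact Ideal.add_mem _ (Ideal.mul_mem_left _ _ hv) (Ideal.mul_mem_left _ _ hu)
  | add u v hu hv =>
    rw [map_add, map_add, add_sub_add_comm]
    exact Ideal.add_mem _ hu hv

/-- The Lie algebra homomorphism to a commutative algebra given by a linear map which vanishes on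
brackets. -/
def lieHomOfForall {A : Type*} [CommRing A] [Algebra O A] (l : L →ₗ[O] A)
    (h : ∀ x y : L, l ⁅x, y⁆ = 0) : L →ₗ⁅O⁆ A where
  __ := l
  map_lie' {x y} := by
    rw [LieRing.of_associative_ring_bracket, mul_comm, sub_self]
    exact h x y

instance {f : L →ₗ[O] O} {hf : ∀ x y : L, f ⁅x, y⁆ = 0} [IsNoetherianRing O] [Module.Finite O L] :
    Module.Finite O (kerSubalgebra f hf) :=
  inferInstanceAs (Module.Finite O (LinearMap.ker f))

instance {f : L →ₗ[O] O} {hf : ∀ x y : L, f ⁅x, y⁆ = 0} [Module.IsTorsionFree O L] :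
    Module.IsTorsionFree O (kerSubalgebra f hf) :=
  inferInstanceAs (Module.IsTorsionFree O (LinearMap.ker f))

instance (M : LieSubalgebra O L) [LieRing.IsNilpotent L] : LieRing.IsNilpotent M :=
  Function.Injective.lieAlgebra_isNilpotent (f := M.incl) Subtype.val_injective

theorem isolator_comap_incl [IsDomain O] {M B : LieSubalgebra O L}
    (h : isolator B.toSubmodule = B.toSubmodule) :
    isolator (B.comap M.incl).toSubmodule = (B.comap M.incl).toSubmodule := by
  refine le_antisymm ?_ (le_isolator _)
  rintro u ⟨t, ht, hu⟩
  have : (u : L) ∈ isolator B.toSubmodule := ⟨t, ht, hu⟩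
  rw [h] at this
  exact this

/-- For `B = L` the quotient embeds in `O` through the character. Otherwise `B` lies in the kernel
of a surjective form and the question passes to coefficients there; the Lie algebra is therefore
quantified inside the induction on the rank. -/
theorem mem_of_smul_mem_characterIdeal_aux [IsDomain O] [IsPrincipalIdealRing O] {r : O}
    (hr : r ≠ 0) (n : ℕ) : ∀ (L : Type*) [LieRing L] [LieAlgebra O L] [Module.Finite O L]
    [Module.IsTorsionFree O L] [LieRing.IsNilpotent L] (_ : Module.finrank O L = n)
    (l : L →ₗ[O] O) (B : LieSubalgebra O L) (_ : isolator B.toSubmodule = B.toSubmodule)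
    (_ : ∀ x ∈ B, ∀ y ∈ B, l ⁅x, y⁆ = 0) (u : UniversalEnvelopingAlgebra O L)
    (_ : r • u ∈ characterIdeal l B), u ∈ characterIdeal l B := by
  induction n using Nat.strong_induction_on with
  | _ n ih =>
    intro L _ _ _ _ _ hn l B hB hl u hu
    by_cases hT : B = ⊤
    · subst hT
      let χ := UniversalEnvelopingAlgebra.lift O
        (lieHomOfForall l fun x y ↦ hl x (LieSubalgebra.mem_top x) y (LieSubalgebra.mem_top y))
      have hχ x : χ (UniversalEnvelopingAlgebra.ι O x) = l x :=
        UniversalEnvelopingAlgebra.lift_ι_apply O _ x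
      have hle : characterIdeal l ⊤ ≤ RingHom.ker χ := by
        refine Ideal.span_le.mpr ?_
        rintro _ ⟨w, -, rfl⟩
        simp only [SetLike.mem_coe, RingHom.mem_ker, map_sub, AlgHom.commutes, hχ]
        simp
      have h0 : r * χ u = 0 := by simpa [RingHom.mem_ker] using hle hu
      have h1 := sub_algebraMap_mem_characterIdeal l χ hχ u
      rwa [(mul_eq_zero.mp h0).resolve_left hr, map_zero, sub_zero] at h1
    · obtain ⟨f, hf, hfB, x, hx⟩ := exists_form_of_ne_top hB hT
      have hle : B ≤ kerSubalgebra f hf := hfB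
      rw [← map_characterIdeal hle, mem_map_envelopingIncl_iff hx] at hu ⊢
      intro i
      have hi := hu i
      rw [map_smul, Finsupp.smul_apply] at hi
      exact ih _ (hn ▸ finrank_ker_lt hx) _ rfl _ _ (isolator_comap_incl hB)
        (fun x hx y hy ↦ hl _ hx _ hy) _ hi

/-- The quotient of the enveloping algebra by the left ideal attached to a character of an isolated
subalgebra is torsion-free. -/
theorem mem_of_smul_mem_characterIdeal [IsDomain O] [IsPrincipalIdealRing O]
    [Module.Finite O L] [Module.IsTorsionFree O L] [LieRing.IsNilpotent L] {l : L →ₗ[O] O}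
    {B : LieSubalgebra O L} (hB : isolator B.toSubmodule = B.toSubmodule)
    (hl : ∀ x ∈ B, ∀ y ∈ B, l ⁅x, y⁆ = 0) {r : O} (hr : r ≠ 0)
    {u : UniversalEnvelopingAlgebra O L} (hu : r • u ∈ characterIdeal l B) :
    u ∈ characterIdeal l B :=
  mem_of_smul_mem_characterIdeal_aux hr _ L rfl l B hB hl u hu

end Torsion

/-! ### Compatible sequences and the annihilation condition -/

section Annihilates

variable {O : Type*} [CommRing O] {L : Type*} [LieRing L] [LieAlgebra O L]

/-- The terms of the sequence `a` annihilate the cyclic modules attached to a character of `B`,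
modulo increasing powers of `J`. -/
def Annihilates (J : Ideal O) (l : L →ₗ[O] O) (B : LieSubalgebra O L)
    (a : ℕ → UniversalEnvelopingAlgebra O L) : Prop :=
  ∀ n v, a n * v ∈ approxIdeal J l B n

/-- The inductive descent from `L` to `ker f`. Since `coefficients` is right linear over `U(ker f)`,
the multipliers from `U(ker f)` are absorbed into `v`. -/
theorem annihilates_iff_coefficients {J : Ideal O} {l : L →ₗ[O] O} {f : L →ₗ[O] O}
    {hf : ∀ x y : L, f ⁅x, y⁆ = 0} {x : L} (hx : f x = 1) {B : LieSubalgebra O L}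
    (hB : B ≤ kerSubalgebra f hf) (a : ℕ → UniversalEnvelopingAlgebra O L) :
    Annihilates J l B a ↔ ∀ v i, Annihilates J
      (l.comp (kerSubalgebra f hf).toSubmodule.subtype) (B.comap (kerSubalgebra f hf).incl)
      fun n ↦ coefficients (hf := hf) hx (a n * v) i := by
  constructor
  · intro h v i n w
    have h1 := h n (v * envelopingIncl _ w)
    rw [← map_approxIdeal hB, mem_map_envelopingIncl_iff hx] at h1
    have h2 := h1 i
    rwa [← mul_assoc, coefficients_mul] at h2
  · intro h n v
    rw [← map_approxIdeal hB, mem_map_envelopingIncl_iff hx]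
    intro i
    simpa using h v i n 1

/-- Two consecutive terms of the sequence agree modulo increasing powers of `J`. -/
def IsCompatible {A : Type*} [Ring A] [Algebra O A] (J : Ideal O) (a : ℕ → A) : Prop :=
  ∀ n, a (n + 1) - a n ∈ powIdeal J A n

theorem mem_powIdeal_iff {A : Type*} [Ring A] [Algebra O A] {J : Ideal O} {π : O}
    (hJ : J = Ideal.span {π}) {n : ℕ} {u : A} : u ∈ powIdeal J A n ↔ ∃ w : A, u = π ^ n • w := by
  rw [powIdeal, hJ, Ideal.span_singleton_pow, Ideal.map_span, Set.image_singleton,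
    Ideal.mem_span_singleton']
  refine exists_congr fun w ↦ ?_
  rw [← Algebra.commutes, ← Algebra.smul_def, eq_comm]

theorem map_mem_powIdeal {A A' : Type*} [Ring A] [Algebra O A] [Ring A'] [Algebra O A']
    {J : Ideal O} (φ : A →ₗ[O] A') {n : ℕ} {u : A} (hu : u ∈ powIdeal J A n) :
    φ u ∈ powIdeal J A' n := by
  suffices H : ∀ v, φ (v * u) ∈ powIdeal J A' n by simpa using H 1
  refine Submodule.span_induction (p := fun u _ ↦ ∀ v, φ (v * u) ∈ powIdeal J A' n)
    ?_ ?_ ?_ ?_ hu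
  · rintro _ ⟨r, hr, rfl⟩ v
    rw [← Algebra.commutes, ← Algebra.smul_def, map_smul, Algebra.smul_def, Algebra.commutes]
    exact Ideal.mul_mem_left _ _ (Ideal.mem_map_of_mem _ hr)
  · simp
  · intro a b _ _ ha hb v
    rw [mul_add, map_add]
    exact Ideal.add_mem _ (ha v) (hb v)
  · intro c a _ ha v
    rw [smul_eq_mul, ← mul_assoc]
    exact ha _

theorem IsCompatible.map {A A' : Type*} [Ring A] [Algebra O A] [Ring A'] [Algebra O A']
    {J : Ideal O} (φ : A →ₗ[O] A') {a : ℕ → A} (ha : IsCompatible J a) :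
    IsCompatible J fun n ↦ φ (a n) := fun n ↦ by
  rw [← map_sub]
  exact map_mem_powIdeal φ (ha n)

theorem IsCompatible.mul_right {A : Type*} [Ring A] [Algebra O A]
    {J : Ideal O} {a : ℕ → A} (ha : IsCompatible J a) (v : A) :
    IsCompatible J fun n ↦ a n * v := ha.map (LinearMap.mulRight O v)

theorem IsCompatible.sub_mem {A : Type*} [Ring A] [Algebra O A]
    {J : Ideal O} {a : ℕ → A} (ha : IsCompatible J a) (n k : ℕ) :
    a (n + k) - a n ∈ powIdeal J A n := by
  induction k with
  | zero => simp
  | succ k hk =>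
    rw [← sub_add_sub_cancel _ (a (n + k))]
    exact Ideal.add_mem _ (powIdeal_anti J A (Nat.le_add_right n k) (ha (n + k))) hk

/-- Limits of compatible sequences in a discrete valuation ring have no torsion. -/
theorem IsCompatible.mem_of_mul_mem [IsDomain O] [IsDiscreteValuationRing O] {c : ℕ → O}
    (hc : IsCompatible (maximalIdeal O) c) {d : O} (hd : d ≠ 0)
    (h : ∀ n, d * c n ∈ maximalIdeal O ^ n) (n : ℕ) : c n ∈ maximalIdeal O ^ n := by
  obtain ⟨π, hπ⟩ := IsDiscreteValuationRing.exists_irreducible O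
  obtain ⟨e, ε, he⟩ := IsDiscreteValuationRing.associated_pow_irreducible hd hπ
  -- Up to a unit `d` is `π ^ e`: dividing costs `e` powers, so start from the term of index `n + e`
  -- and return to `c n` by compatibility.
  have h1 := h (n + e)
  have h2 : c (n + e) ∈ maximalIdeal O ^ n := by
    rw [hπ.maximalIdeal_eq, Ideal.span_singleton_pow, Ideal.mem_span_singleton] at h1 ⊢
    obtain ⟨s, hs⟩ := h1
    refine ⟨ε * s, mul_left_cancel₀ (pow_ne_zero e hπ.ne_zero) ?_⟩
    rw [← he]
    calc d * ε * c (n + e) = ε * (d * c (n + e)) := by ring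
      _ = ε * (π ^ (n + e) * s) := by rw [hs]
      _ = π ^ e * (π ^ n * (ε * s)) := by ring
      _ = d * ε * (π ^ n * (ε * s)) := by rw [he]
  have h3 := hc.sub_mem n e
  rw [powIdeal_self] at h3
  simpa using Ideal.sub_mem _ h2 h3

end Annihilates

/-! ### The Heisenberg case -/

section Heisenberg

open Polynomial

variable {O : Type*} [CommRing O] {L : Type*} [LieRing L] [LieAlgebra O L]

/-- The left ideal attached to an ideal of `L` on which the linear form is invariant is
two-sided. -/
theorem isTwoSided_characterIdeal {l : L →ₗ[O] O} {C : LieSubalgebra O L}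
    (hC : ∀ u : L, ∀ w ∈ C, ⁅u, w⁆ ∈ C) (hl : ∀ u : L, ∀ w ∈ C, l ⁅u, w⁆ = 0) :
    (characterIdeal l C).IsTwoSided where
  mul_mem_of_left {z} b hz := by
    induction b using enveloping_induction generalizing z with
    | algebraMap r =>
      rw [← Algebra.commutes]
      exact Ideal.mul_mem_left _ _ hz
    | ι x =>
      refine Submodule.span_induction
        (p := fun z _ ↦ z * UniversalEnvelopingAlgebra.ι O x ∈ characterIdeal l C)
        ?_ ?_ ?_ ?_ hz
      · rintro _ ⟨w, hw, rfl⟩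
        have e : (UniversalEnvelopingAlgebra.ι O w - algebraMap O _ (l w)) *
            UniversalEnvelopingAlgebra.ι O x = UniversalEnvelopingAlgebra.ι O x *
            (UniversalEnvelopingAlgebra.ι O w - algebraMap O _ (l w)) -
            (UniversalEnvelopingAlgebra.ι O ⁅x, w⁆ - algebraMap O _ (l ⁅x, w⁆)) := by
          rw [hl x w hw, LieHom.map_lie, LieRing.of_associative_ring_bracket, map_zero, sub_mul,
            mul_sub, Algebra.commutes]
          abel
        simp only [e]
        exact Ideal.sub_mem _ (Ideal.mul_mem_left _ _ (sub_mem_characterIdeal hw))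
          (sub_mem_characterIdeal (hC x w hw))
      · simp
      · intro a b _ _ ha hb
        rw [add_mul]
        exact Ideal.add_mem _ ha hb
      · intro c a _ ha
        rw [smul_eq_mul, mul_assoc]
        exact Ideal.mul_mem_left _ _ ha
    | mul u v hu hv =>
      rw [← mul_assoc]
      exact hv (hu hz)
    | add u v hu hv =>
      rw [mul_add]
      exact Ideal.add_mem _ (hu hz) (hv hz)

theorem isTwoSided_approxIdeal {l : L →ₗ[O] O} {C : LieSubalgebra O L}
    (h : (characterIdeal l C).IsTwoSided) (J : Ideal O) (n : ℕ) :
    (approxIdeal J l C n).IsTwoSided where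
  mul_mem_of_left {z} b hz := by
    obtain ⟨c, hc, d, hd, rfl⟩ := Submodule.mem_sup.mp hz
    rw [add_mul]
    exact Submodule.add_mem_sup (Ideal.mul_mem_right _ _ hc) (Ideal.mul_mem_right _ _ hd)

/-- The homomorphism from the enveloping algebra of `L` to the polynomial ring which sends `x` to
`l x + m x X`. -/
def polynomialHom (l m : L →ₗ[O] O) (hl : ∀ x y : L, l ⁅x, y⁆ = 0)
    (hm : ∀ x y : L, m ⁅x, y⁆ = 0) : UniversalEnvelopingAlgebra O L →ₐ[O] O[X] :=
  UniversalEnvelopingAlgebra.lift O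
    (lieHomOfForall (Polynomial.monomial 0 ∘ₗ l + Polynomial.monomial 1 ∘ₗ m) fun x y ↦ by
      simp [hl, hm])

variable {l m : L →ₗ[O] O} {hl : ∀ x y : L, l ⁅x, y⁆ = 0} {hm : ∀ x y : L, m ⁅x, y⁆ = 0}

theorem polynomialHom_ι (x : L) :
    polynomialHom l m hl hm (UniversalEnvelopingAlgebra.ι O x) = C (l x) + C (m x) * X := by
  rw [polynomialHom, UniversalEnvelopingAlgebra.lift_ι_apply, C_mul_X_eq_monomial]
  rfl

/-- The elements of the enveloping algebra on which `polynomialHom` vanishes modulo `Jⁿ`. -/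
theorem mem_approxIdeal_of_polynomialHom {M : LieSubalgebra O L}
    (hM : ∀ x, x ∈ M ↔ m x = 0) {y : L} (hy : m y = 1) {J : Ideal O} {n : ℕ}
    {u : UniversalEnvelopingAlgebra O L}
    (hu : ∀ i, (polynomialHom l m hl hm u).coeff i ∈ J ^ n) : u ∈ approxIdeal J l M n := by
  have : (characterIdeal l M).IsTwoSided :=
    isTwoSided_characterIdeal (fun u w _ ↦ (hM _).mpr (hm u w)) fun u w _ ↦ hl u w
  -- `polynomialHom` sends `Y` to `X`, so evaluation at `Y` splits it and recovers every element
  -- modulo the two-sided ideal of `M`.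
  let Y : UniversalEnvelopingAlgebra O L :=
    UniversalEnvelopingAlgebra.ι O y - algebraMap O _ (l y)
  have H (u) : u - aeval Y (polynomialHom l m hl hm u) ∈ characterIdeal l M := by
    induction u using enveloping_induction with
    | algebraMap r => simp
    | ι x =>
      have e : UniversalEnvelopingAlgebra.ι O x -
          aeval Y (polynomialHom l m hl hm (UniversalEnvelopingAlgebra.ι O x)) =
          UniversalEnvelopingAlgebra.ι O (x - m x • y) - algebraMap O _ (l (x - m x • y)) := by
        simp only [polynomialHom_ι, map_add, map_mul, aeval_C, aeval_X, Y, map_sub, map_smul,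
          smul_eq_mul, Algebra.smul_def, mul_sub]
        abel
      rw [e]
      exact sub_mem_characterIdeal ((hM _).mpr (by simp [hy]))
    | mul u v hu hv =>
      have e : u * v - aeval Y (polynomialHom l m hl hm (u * v)) =
          u * (v - aeval Y (polynomialHom l m hl hm v)) +
          (u - aeval Y (polynomialHom l m hl hm u)) * aeval Y (polynomialHom l m hl hm v) := by
        rw [map_mul, map_mul]
        noncomm_ring
      rw [e]
      exact Ideal.add_mem _ (Ideal.mul_mem_left _ _ hv) (Ideal.mul_mem_right _ _ hu)
    | add u v hu hv =>
      rw [map_add, map_add, add_sub_add_comm]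
      exact Ideal.add_mem _ hu hv
  rw [← sub_add_cancel u (aeval Y (polynomialHom l m hl hm u))]
  refine Submodule.add_mem_sup (H u) ?_
  rw [aeval_eq_sum_range]
  refine Submodule.sum_mem _ fun i _ ↦ ?_
  rw [Algebra.smul_def, Algebra.commutes]
  exact Ideal.mul_mem_left _ _ (Ideal.mem_map_of_mem _ (hu i))

/-- Evaluation at `X = 0` is the character extending `l`, which kills every `w - l w`. -/
theorem coeff_zero_polynomialHom_mem {J : Ideal O} {M : LieSubalgebra O L} {n : ℕ}
    {u : UniversalEnvelopingAlgebra O L} (hu : u ∈ approxIdeal J l M n) :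
    (polynomialHom l m hl hm u).coeff 0 ∈ J ^ n := by
  let θ := (aeval (0 : O)).comp (polynomialHom l m hl hm)
  have h0 v : θ v = (polynomialHom l m hl hm v).coeff 0 := by
    rw [coeff_zero_eq_aeval_zero]
    rfl
  rw [← h0]
  suffices H : approxIdeal J l M n ≤ (J ^ n).comap (θ : UniversalEnvelopingAlgebra O L →+* O) from
    H hu
  refine sup_le (Ideal.span_le.mpr ?_) ?_
  · rintro _ ⟨w, -, rfl⟩
    have : θ (UniversalEnvelopingAlgebra.ι O w - algebraMap O _ (l w)) = 0 := by
      rw [map_sub, AlgHom.commutes, h0, polynomialHom_ι]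
      simp
    simp only [SetLike.mem_coe, Ideal.mem_comap, RingHom.coe_coe, this, Ideal.zero_mem]
  · have := powIdeal_le_comap J θ n
    rwa [powIdeal_self] at this

/-- Commutation with an element acting on `L` through a derivation of `polynomialHom`. -/
theorem exists_mul_ι_eq {f : L →ₗ[O] O} {hf : ∀ x y : L, f ⁅x, y⁆ = 0} {x : L}
    {l m : kerSubalgebra f hf →ₗ[O] O} {hl : ∀ x y : kerSubalgebra f hf, l ⁅x, y⁆ = 0}
    {hm : ∀ x y : kerSubalgebra f hf, m ⁅x, y⁆ = 0} {γ : O}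
    (h₁ : ∀ u, l (adKer f hf x u) = γ * m u) (h₂ : ∀ u, m (adKer f hf x u) = 0)
    (b : UniversalEnvelopingAlgebra O (kerSubalgebra f hf)) :
    ∃ b', envelopingIncl _ b * UniversalEnvelopingAlgebra.ι O x =
      UniversalEnvelopingAlgebra.ι O x * envelopingIncl _ b - envelopingIncl _ b' ∧
      polynomialHom l m hl hm b' = γ • derivative (polynomialHom l m hl hm b) := by
  induction b using enveloping_induction with
  | algebraMap r => exact ⟨0, by simp [Algebra.commutes], by simp⟩
  | ι y =>
    refine ⟨UniversalEnvelopingAlgebra.ι O (adKer f hf x y), ?_, ?_⟩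
    · rw [envelopingIncl_ι, envelopingIncl_ι]
      change _ = _ - UniversalEnvelopingAlgebra.ι O ⁅x, (y : L)⁆
      rw [LieHom.map_lie, LieRing.of_associative_ring_bracket]
      abel
    · rw [polynomialHom_ι, polynomialHom_ι, h₁, h₂]
      simp [smul_eq_C_mul]
  | mul u v hu hv =>
    obtain ⟨u', hu, hu'⟩ := hu
    obtain ⟨v', hv, hv'⟩ := hv
    refine ⟨u' * v + u * v', ?_, ?_⟩
    · rw [map_mul, mul_assoc, hv, mul_sub, ← mul_assoc, hu, map_add, map_mul, map_mul]
      noncomm_ring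
    · rw [map_add, map_mul, map_mul, map_mul, derivative_mul, hu', hv', smul_add, smul_mul_assoc,
        mul_smul_comm]
  | add u v hu hv =>
    obtain ⟨u', hu, hu'⟩ := hu
    obtain ⟨v', hv, hv'⟩ := hv
    refine ⟨u' + v', ?_, ?_⟩
    · rw [map_add, map_add, add_mul, mul_add, hu, hv]
      abel
    · rw [map_add, map_add, map_add, smul_add, hu', hv']

/-- On polynomial coefficients, right multiplication by `x` is the degree shift minus `γ d/dX`: the
derivative measures the commutator of `x` with `U(ker f)`. -/
theorem mapRange_coefficients_mul_ι {f : L →ₗ[O] O} {hf : ∀ x y : L, f ⁅x, y⁆ = 0} {x : L}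
    (hx : f x = 1)
    {l m : kerSubalgebra f hf →ₗ[O] O} {hl : ∀ x y : kerSubalgebra f hf, l ⁅x, y⁆ = 0}
    {hm : ∀ x y : kerSubalgebra f hf, m ⁅x, y⁆ = 0} {γ : O}
    (h₁ : ∀ u, l (adKer f hf x u) = γ * m u) (h₂ : ∀ u, m (adKer f hf x u) = 0)
    (u : UniversalEnvelopingAlgebra O L) :
    Finsupp.mapRange.linearMap (polynomialHom l m hl hm).toLinearMap
        (coefficients hx (u * UniversalEnvelopingAlgebra.ι O x)) =
      Finsupp.lmapDomain _ O Nat.succ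
        (Finsupp.mapRange.linearMap (polynomialHom l m hl hm).toLinearMap (coefficients hx u)) -
      γ • Finsupp.mapRange.linearMap (derivative ∘ₗ (polynomialHom l m hl hm).toLinearMap)
        (coefficients hx u) := by
  rw [← ofCoefficients_coefficients (hf := hf) hx u]
  induction coefficients (hf := hf) hx u using Finsupp.induction_linear with
  | zero => simp
  | add a b ha hb =>
    simp only [map_add, add_mul, smul_add, ha, hb]
    abel
  | single i b =>
    obtain ⟨b', hb, hb'⟩ := exists_mul_ι_eq (hl := hl) (hm := hm) h₁ h₂ b
    rw [ofCoefficients_single, mul_assoc, hb, mul_sub, ← mul_assoc, ← pow_succ, map_sub,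
      coefficients_pow_mul, coefficients_pow_mul, coefficients_pow_mul, map_sub]
    simp only [Finsupp.mapRange.linearMap_apply, Finsupp.mapRange_single, AlgHom.toLinearMap_apply,
      Finsupp.lmapDomain_apply, Finsupp.mapDomain_single, LinearMap.comp_apply, hb',
      Finsupp.smul_single]

variable [IsDomain O] [IsDiscreteValuationRing O] [CharZero O]

/-- For a subalgebra of codimension one acting in the manner of a Heisenberg algebra, a compatible
sequence annihilates the induced module only if it is trivial modulo the radical. -/
theorem annihilates_iff_of_heisenberg {f : L →ₗ[O] O} {hf : ∀ x y : L, f ⁅x, y⁆ = 0} {x : L}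
    (hx : f x = 1) {l : L →ₗ[O] O} (hl : ∀ u v : kerSubalgebra f hf, l ⁅(u : L), (v : L)⁆ = 0)
    {m : kerSubalgebra f hf →ₗ[O] O} (hm : ∀ u v : kerSubalgebra f hf, m ⁅u, v⁆ = 0)
    (hm' : ∀ u, m (adKer f hf x u) = 0) {y : kerSubalgebra f hf} (hy : m y = 1)
    {M : LieSubalgebra O L} (hMf : M ≤ kerSubalgebra f hf)
    (hM : ∀ u : kerSubalgebra f hf, (u : L) ∈ M ↔ m u = 0) (hMl : ∀ u : L, ∀ w ∈ M, l ⁅u, w⁆ = 0)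
    (hγ : l ⁅x, (y : L)⁆ ≠ 0) {a : ℕ → UniversalEnvelopingAlgebra O L}
    (ha : IsCompatible (maximalIdeal O) a) :
    Annihilates (maximalIdeal O) l (kerSubalgebra f hf) a ↔
      ∀ n, a n ∈ approxIdeal (maximalIdeal O) l M n := by
  set γ : O := l ⁅x, (y : L)⁆
  let l' : kerSubalgebra f hf →ₗ[O] O := l.comp (kerSubalgebra f hf).toSubmodule.subtype
  have hl' (u v : kerSubalgebra f hf) : l' ⁅u, v⁆ = 0 := hl u v
  have h₁ u : l' (adKer f hf x u) = γ * m u := by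
    have h := hMl x ((u - m u • y : kerSubalgebra f hf) : L) ((hM _).mpr (by simp [hy]))
    change l ⁅x, (u : L) - m u • (y : L)⁆ = 0 at h
    rw [lie_sub, lie_smul, map_sub, map_smul, smul_eq_mul, sub_eq_zero] at h
    exact h.trans (mul_comm _ _)
  let ψ := polynomialHom l' m hl' hm
  have hrec (u : UniversalEnvelopingAlgebra O L) := mapRange_coefficients_mul_ι
    (hl := hl') (hm := hm) hx h₁ hm' u
  constructor
  · intro h n
    have hcoeff (v : UniversalEnvelopingAlgebra O L) (i n : ℕ) :
        (ψ (coefficients (hf := hf) hx (a n * v) i)).coeff 0 ∈ maximalIdeal O ^ n := by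
      have h1 := h n v
      rw [← map_approxIdeal le_rfl, mem_map_envelopingIncl_iff hx] at h1
      exact coeff_zero_polynomialHom_mem (h1 i)
    let D : Module.End O O[X] := γ • derivative
    -- The multiplier `v` is arbitrary, so `v x` may replace it; the recursion expresses one further
    -- application of `D` through the coefficients for `v` and `v x`.
    have hD (k : ℕ) : ∀ (v : UniversalEnvelopingAlgebra O L) (i n : ℕ),
        ((D ^ k) (ψ (coefficients (hf := hf) hx (a n * v) i))).coeff 0 ∈ maximalIdeal O ^ n := by
      induction k with
      | zero => exact hcoeff
      | succ k hk =>
        intro v i n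
        have h1 := DFunLike.congr_fun (hrec (a n * v)) i
        simp only [Finsupp.mapRange.linearMap_apply, Finsupp.mapRange_apply, Finsupp.sub_apply,
          Finsupp.smul_apply, LinearMap.comp_apply, AlgHom.toLinearMap_apply,
          Finsupp.lmapDomain_apply] at h1
        rw [pow_succ, Module.End.mul_apply]
        change ((D ^ k) (γ • derivative (ψ _))).coeff 0 ∈ _
        rw [eq_sub_iff_add_eq', ← eq_sub_iff_add_eq] at h1
        rw [h1, map_sub, coeff_sub, mul_assoc]
        refine Ideal.sub_mem _ ?_ (hk _ i n)
        cases i with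
        | zero =>
          -- In degree `0` the shifted term vanishes.
          rw [Finsupp.mapDomain_of_notMem_range _ _ (by simp)]
          simp
        | succ i =>
          rw [Finsupp.mapDomain_apply Nat.succ_injective]
          exact hk v i n
    rw [← map_approxIdeal hMf, mem_map_envelopingIncl_iff hx]
    intro i
    refine mem_approxIdeal_of_polynomialHom (hl := hl') (hm := hm) hM hy fun k ↦ ?_
    -- The constant term of `D ^ k` is `γ ^ k k!` times the `k`-th coefficient. Characteristic zero
    -- makes this factor nonzero, and compatibility of the sequence allows its cancellation.
    have hd : γ ^ k * (k.factorial : O) ≠ 0 :=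
      mul_ne_zero (pow_ne_zero k hγ) (Nat.cast_ne_zero.mpr k.factorial_ne_zero)
    let φ : UniversalEnvelopingAlgebra O L →ₗ[O] O := lcoeff O k ∘ₗ ψ.toLinearMap ∘ₗ
      Finsupp.lapply i ∘ₗ coefficients (hf := hf) hx
    refine IsCompatible.mem_of_mul_mem (ha.map φ) hd (fun n ↦ ?_) n
    have h1 := hD k 1 i n
    rw [mul_one, _root_.smul_pow, LinearMap.smul_apply, coeff_smul, Module.End.pow_apply,
      coeff_iterate_derivative, zero_add, Nat.descFactorial_self, nsmul_eq_mul, smul_eq_mul,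
      ← mul_assoc] at h1
    exact h1
  · intro h n v
    have hC (u w : L) (hw : w ∈ M) : ⁅u, w⁆ ∈ M := by
      let w' : kerSubalgebra f hf := ⟨w, hMf hw⟩
      have hw' : m w' = 0 := (hM w').mp hw
      have e : ⁅u, w⁆ =
          ((f u • adKer f hf x w' + ⁅kerPart (hf := hf) hx u, w'⁆ : kerSubalgebra f hf) : L) := by
        change ⁅u, w⁆ = f u • ⁅x, w⁆ + ⁅u - f u • x, w⁆
        rw [sub_lie, smul_lie]
        abel
      rw [e, hM, map_add, map_smul, hm', hm, smul_zero, add_zero]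
    -- `M` is an ideal in the radical of the form, so its left ideal absorbs right multiplication.
    have := isTwoSided_approxIdeal (isTwoSided_characterIdeal hC hMl) (maximalIdeal O) n
    exact approxIdeal_mono hMf n (Ideal.mul_mem_right _ _ (h n))

end Heisenberg

/-! ### Lagrangian subalgebras and their replacement -/

section LatticePolarisation

variable {O : Type*} [CommRing O] {L : Type*} [LieRing L] [LieAlgebra O L]

/-- A subalgebra which is its own orthogonal for the alternating form attached to `l`. -/
def IsLagrangian (l : L →ₗ[O] O) (B : LieSubalgebra O L) : Prop :=
  ∀ u, u ∈ B ↔ ∀ w ∈ B, l ⁅u, w⁆ = 0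

variable {l : L →ₗ[O] O} {B : LieSubalgebra O L}

theorem IsLagrangian.lie_eq_zero (h : IsLagrangian l B) {u w : L} (hu : u ∈ B) (hw : w ∈ B) :
    l ⁅u, w⁆ = 0 :=
  (h u).mp hu w hw

theorem IsLagrangian.mem_of_smul_mem [IsDomain O] (h : IsLagrangian l B) {t : O} (ht : t ≠ 0) {u : L}
    (hu : t • u ∈ B) : u ∈ B := by
  refine (h u).mpr fun w hw ↦ ?_
  have h1 := h.lie_eq_zero hu hw
  rw [smul_lie, map_smul, smul_eq_mul] at h1
  exact (mul_eq_zero.mp h1).resolve_left ht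

theorem IsLagrangian.isolator_eq [IsDomain O] (h : IsLagrangian l B) :
    isolator B.toSubmodule = B.toSubmodule :=
  le_antisymm (fun _ ⟨_, ht, hu⟩ ↦ h.mem_of_smul_mem ht hu) (le_isolator _)

theorem IsLagrangian.comap {M : LieSubalgebra O L} (h : IsLagrangian l B) (hM : B ≤ M) :
    IsLagrangian (l.comp M.toSubmodule.subtype) (B.comap M.incl) := fun u ↦
  ⟨fun hu _ hw ↦ h.lie_eq_zero hu hw, fun hu ↦ (h u).mpr fun w hw ↦ hu ⟨w, hM hw⟩ hw⟩

/-- The linear form `u ↦ l [u, y]`. -/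
def bracketForm (l : L →ₗ[O] O) (y : L) : L →ₗ[O] O where
  toFun u := l ⁅u, y⁆
  map_add' u v := by rw [add_lie, map_add]
  map_smul' r u := by rw [smul_lie, map_smul, RingHom.id_apply]

section Adjoin

variable [IsDomain O]

/-- The isolated subalgebra generated by a subalgebra and an element normalising it. -/
def adjoinElement (C : LieSubalgebra O L) (y : L) (hC : ∀ c ∈ C, ⁅c, y⁆ ∈ C) :
    LieSubalgebra O L where
  __ := isolator (C.toSubmodule ⊔ Submodule.span O {y})
  lie_mem' := by
    rintro u v ⟨t, ht, hu⟩ ⟨s, hs, hv⟩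
    obtain ⟨c, hc, _, hd, hu⟩ := Submodule.mem_sup.mp hu
    obtain ⟨r, rfl⟩ := Submodule.mem_span_singleton.mp hd
    obtain ⟨c', hc', _, hd', hv⟩ := Submodule.mem_sup.mp hv
    obtain ⟨r', rfl⟩ := Submodule.mem_span_singleton.mp hd'
    refine ⟨t * s, mul_ne_zero ht hs, Submodule.mem_sup_left ?_⟩
    have e : (t * s) • ⁅u, v⁆ = ⁅c, c'⁆ + r' • ⁅c, y⁆ - r • ⁅c', y⁆ := by
      rw [mul_smul, ← lie_smul, ← smul_lie, ← hu, ← hv, add_lie, lie_add, lie_add, smul_lie,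
        lie_smul, lie_smul, smul_lie, lie_self, ← lie_skew c' y, smul_zero, smul_zero, smul_neg, add_zero]
      abel
    rw [e]
    exact C.sub_mem (C.add_mem (C.lie_mem hc hc') (C.smul_mem _ (hC c hc)))
      (C.smul_mem _ (hC c' hc'))

theorem mem_adjoinElement {C : LieSubalgebra O L} {y : L} {hC : ∀ c ∈ C, ⁅c, y⁆ ∈ C} {u : L} :
    u ∈ adjoinElement C y hC ↔ ∃ t : O, t ≠ 0 ∧ ∃ c ∈ C, ∃ s : O, t • u = c + s • y := by
  change (∃ t : O, t ≠ 0 ∧ t • u ∈ _) ↔ _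
  refine exists_congr fun t ↦ and_congr_right fun _ ↦ ?_
  rw [Submodule.mem_sup]
  constructor
  · rintro ⟨c, hc, _, hd, hu⟩
    obtain ⟨s, rfl⟩ := Submodule.mem_span_singleton.mp hd
    exact ⟨c, hc, s, hu.symm⟩
  · rintro ⟨c, hc, s, hu⟩
    exact ⟨c, hc, _, Submodule.mem_span_singleton.mpr ⟨s, rfl⟩, hu.symm⟩

theorem le_adjoinElement {C : LieSubalgebra O L} {y : L} {hC : ∀ c ∈ C, ⁅c, y⁆ ∈ C} :
    C ≤ adjoinElement C y hC := fun c hc ↦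
  mem_adjoinElement.mpr ⟨1, one_ne_zero, c, hc, 0, by simp⟩

theorem mem_adjoinElement_self {C : LieSubalgebra O L} {y : L} {hC : ∀ c ∈ C, ⁅c, y⁆ ∈ C} :
    y ∈ adjoinElement C y hC :=
  mem_adjoinElement.mpr ⟨1, one_ne_zero, 0, C.zero_mem, 1, by simp⟩

theorem isolator_adjoinElement {C : LieSubalgebra O L} {y : L} {hC : ∀ c ∈ C, ⁅c, y⁆ ∈ C} :
    isolator (adjoinElement C y hC).toSubmodule = (adjoinElement C y hC).toSubmodule :=
  isolator_isolator _

end Adjoin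

/-- An element `y` which is central modulo elements `N`, themselves central modulo an ideal killed
by `l`. -/
structure IsReducing (l : L →ₗ[O] O) (k N : LieIdeal O L) (y : L) : Prop where
  eq_zero : ∀ u ∈ k, l u = 0
  lie_mem : ∀ u : L, ∀ z ∈ N, ⁅u, z⁆ ∈ k
  lie_self_mem : ∀ u : L, ⁅u, y⁆ ∈ N
  exists_ne : ∃ u : L, l ⁅u, y⁆ ≠ 0

/-- Take `k` the largest ideal in `ker l`, `N` the preimage of the centre of `L / k`, and `y` in the
next step of the upper central series but outside `N`. Such a `y` exists because otherwise
nilpotency would give `N = L`, and `l` would kill all brackets. -/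
theorem exists_isReducing [LieRing.IsNilpotent L] (h : ∃ u v : L, l ⁅u, v⁆ ≠ 0) :
    ∃ k N y, IsReducing l k N y := by
  let k : LieIdeal O L := sSup {I | ∀ u ∈ I, l u = 0}
  have hk : ∀ u ∈ k, l u = 0 := by
    have : k.toSubmodule ≤ LinearMap.ker l := by
      rw [LieSubmodule.sSup_toSubmodule]
      refine sSup_le ?_
      rintro _ ⟨I, hI, rfl⟩
      exact hI
    exact this
  have hle (I : LieIdeal O L) (hI : ∀ u ∈ I, l u = 0) : I ≤ k := le_sSup hI
  let N : LieIdeal O L := k.normalizer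
  -- For `z` central modulo `k`, `k + O z` is an ideal; if `l z = 0`, maximality of `k` absorbs it.
  have hN (z : L) (hz : z ∈ N) (h0 : l z = 0) : z ∈ k := by
    let I : LieIdeal O L :=
      { k.toSubmodule ⊔ Submodule.span O {z} with
        lie_mem := by
          intro x u hu
          obtain ⟨c, hc, _, hd, rfl⟩ := Submodule.mem_sup.mp hu
          obtain ⟨r, rfl⟩ := Submodule.mem_span_singleton.mp hd
          refine Submodule.mem_sup_left ?_
          rw [lie_add, lie_smul]
          exact add_mem (k.lie_mem hc) (k.smul_mem r (hz x)) }
    refine hle I ?_ (Submodule.mem_sup_right (Submodule.mem_span_singleton_self z))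
    intro u hu
    obtain ⟨c, hc, _, hd, rfl⟩ := Submodule.mem_sup.mp hu
    obtain ⟨r, rfl⟩ := Submodule.mem_span_singleton.mp hd
    rw [map_add, map_smul, hk c hc, h0, smul_zero, add_zero]
  have hlt : ¬ N.normalizer ≤ N := by
    intro hle'
    have he : N.normalizer = N := le_antisymm hle' N.le_normalizer
    obtain ⟨i, hi⟩ := (LieModule.isNilpotent_iff_exists_ucs_eq_top (R := O) (L := L) (M := L)).mp inferInstance
    have h1 := LieSubmodule.ucs_mono i (bot_le : ⊥ ≤ N)
    rw [hi, LieSubmodule.ucs_eq_self_of_normalizer_eq_self he, top_le_iff] at h1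
    obtain ⟨u, v, huv⟩ := h
    have hv : v ∈ N := h1 ▸ LieSubmodule.mem_top v
    exact huv (hk _ (hv u))
  obtain ⟨y, hy, hy'⟩ := SetLike.not_le_iff_exists.mp hlt
  refine ⟨k, N, y, hk, fun u z hz ↦ hz u, hy, ?_⟩
  by_contra! h0
  exact hy' fun u ↦ hN _ (hy u) (h0 u)

namespace IsReducing

variable {k N : LieIdeal O L} {y : L}

/-- By the Jacobi identity the double bracket lies in `[L, N] ⊆ k`. Hence `u ↦ l [u, y]` vanishes on
brackets and its kernel is an ideal. -/
theorem lie_lie_eq_zero (h : IsReducing l k N y) (u v : L) : l ⁅⁅u, v⁆, y⁆ = 0 := by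
  rw [lie_lie, map_sub, h.eq_zero _ (h.lie_mem u _ (h.lie_self_mem v)),
    h.eq_zero _ (h.lie_mem v _ (h.lie_self_mem u)), sub_zero]

/-- `N` is orthogonal to all of `L`, hence contained in every Lagrangian subalgebra. -/
theorem mem_lagrangian (h : IsReducing l k N y) (hB : IsLagrangian l B) {z : L} (hz : z ∈ N) :
    z ∈ B :=
  (hB z).mpr fun w _ ↦ by
    rw [← lie_skew, map_neg, h.eq_zero _ (h.lie_mem w z hz), neg_zero]

theorem lie_mem_lagrangian (h : IsReducing l k N y) (hB : IsLagrangian l B) (u : L) :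
    ⁅u, y⁆ ∈ B :=
  h.mem_lagrangian hB (h.lie_self_mem u)

theorem lie_mem_inf (h : IsReducing l k N y) (hB : IsLagrangian l B) (f : L →ₗ[O] O)
    (hf : ∀ x y : L, f ⁅x, y⁆ = 0) (c : L) (_ : c ∈ B ⊓ kerSubalgebra f hf) : ⁅c, y⁆ ∈ B ⊓ kerSubalgebra f hf :=
  ⟨h.lie_mem_lagrangian hB c, hf _ _⟩

/-- The replacement of a Lagrangian subalgebra by one which contains `y`. -/
theorem isLagrangian_adjoinElement [IsDomain O] (h : IsReducing l k N y) (hB : IsLagrangian l B)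
    {f : L →ₗ[O] O} {hf : ∀ x y : L, f ⁅x, y⁆ = 0} (hfy : ∀ u, f u = 0 ↔ l ⁅u, y⁆ = 0) {x : L}
    (hx : x ∈ B) (hxy : l ⁅x, y⁆ ≠ 0) :
    IsLagrangian l (adjoinElement (B ⊓ kerSubalgebra f hf) y (h.lie_mem_inf hB f hf)) := by
  intro u
  constructor
  · intro hu w hw
    obtain ⟨t, ht, c, hc, s, hu⟩ := mem_adjoinElement.mp hu
    obtain ⟨t', ht', c', hc', s', hw⟩ := mem_adjoinElement.mp hw
    have e : (t * t') * l ⁅u, w⁆ = l ⁅c, c'⁆ + s' * l ⁅c, y⁆ - s * l ⁅c', y⁆ := by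
      rw [← smul_eq_mul, ← map_smul, mul_smul, ← lie_smul, ← smul_lie, hu, hw, add_lie, lie_add,
        lie_add, smul_lie, lie_smul, lie_smul, smul_lie, lie_self, ← lie_skew c' y]
      simp only [map_add, map_smul, map_neg, map_zero, smul_eq_mul]
      ring
    rw [hB.lie_eq_zero hc.1 hc'.1, (hfy c).mp hc.2, (hfy c').mp hc'.2, mul_zero, mul_zero,
      sub_zero, add_zero] at e
    exact (mul_eq_zero.mp e).resolve_left (mul_ne_zero ht ht')
  · intro hu
    have huy : l ⁅u, y⁆ = 0 := hu y mem_adjoinElement_self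
    have huc (c : L) (hc : c ∈ B ⊓ kerSubalgebra f hf) : l ⁅u, c⁆ = 0 := hu c (le_adjoinElement hc)
    have hyc (c : L) (hc : c ∈ B ⊓ kerSubalgebra f hf) : l ⁅y, c⁆ = 0 := by
      rw [← lie_skew, map_neg, (hfy c).mp hc.2, neg_zero]
    set d := l ⁅x, y⁆ with hd
    have hyx : l ⁅y, x⁆ = -d := by rw [← lie_skew, map_neg]
    -- The coefficient of `y` makes the corrected multiple of `u` orthogonal to `x`. For general `w`
    -- in `B`, use that `d • w - l [w, y] • x` lies in `B ∩ ker f`.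
    refine mem_adjoinElement.mpr ⟨d, hxy, d • u + l ⁅u, x⁆ • y, ⟨(hB _).mpr fun w hw ↦ ?_,
      (hfy _).mpr ?_⟩, -l ⁅u, x⁆, by module⟩
    · have hc : d • w - l ⁅w, y⁆ • x ∈ B ⊓ kerSubalgebra f hf := by
        refine ⟨B.sub_mem (B.smul_mem _ hw) (B.smul_mem _ hx), (hfy _).mpr ?_⟩
        rw [sub_lie, smul_lie, smul_lie, map_sub, map_smul, map_smul, ← hd, smul_eq_mul,
          smul_eq_mul, mul_comm, sub_self]
      have h1 := huc _ hc
      have h2 := hyc _ hc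
      simp only [lie_sub, lie_smul, map_sub, map_smul, smul_eq_mul, hyx] at h1 h2
      rw [add_lie, smul_lie, smul_lie, map_add, map_smul, map_smul, smul_eq_mul, smul_eq_mul]
      refine mul_left_cancel₀ hxy ?_
      linear_combination d * h1 + l ⁅u, x⁆ * h2
    · rw [add_lie, smul_lie, smul_lie, lie_self, map_add, map_smul, map_smul, huy, map_zero,
        smul_zero, smul_zero, add_zero]

end IsReducing

end LatticePolarisation

/-! ### Independence of the Lagrangian subalgebra -/

section Independence

variable {O : Type*} [CommRing O] [IsDomain O] [IsDiscreteValuationRing O] [CharZero O]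
variable {L : Type*} [LieRing L] [LieAlgebra O L] [Module.Finite O L]

/-- The subalgebra on which two linear forms vanish. -/
theorem annihilates_iff_of_forms {l f g : L →ₗ[O] O} {hf : ∀ x y : L, f ⁅x, y⁆ = 0}
    {hg : ∀ x y : L, g ⁅x, y⁆ = 0} (hl : ∀ u ∈ kerSubalgebra f hf, ∀ v ∈ kerSubalgebra f hf,
      l ⁅u, v⁆ = 0)
    (hM : ∀ u : L, ∀ w ∈ kerSubalgebra f hf ⊓ kerSubalgebra g hg, l ⁅u, w⁆ = 0)
    {x : L} (hx : f x = 1) {y : L} (hyf : f y = 0) (hyg : g y ≠ 0)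
    (h : ∀ u : L, (∀ v : L, l ⁅v, u⁆ = 0) → g u = 0) {a : ℕ → UniversalEnvelopingAlgebra O L}
    (ha : IsCompatible (maximalIdeal O) a) :
    Annihilates (maximalIdeal O) l (kerSubalgebra f hf) a ↔
      ∀ n, a n ∈ approxIdeal (maximalIdeal O) l (kerSubalgebra f hf ⊓ kerSubalgebra g hg) n := by
  let g' : kerSubalgebra f hf →ₗ[O] O := g.comp (kerSubalgebra f hf).toSubmodule.subtype
  have hg' : g' ≠ 0 := fun h0 ↦ hyg (DFunLike.congr_fun h0 ⟨y, hyf⟩)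
  obtain ⟨m, hm, z, hz⟩ := exists_form_ker_eq hg'
  refine annihilates_iff_of_heisenberg hx (fun u v ↦ hl u u.2 v v.2)
    (fun u v ↦ (hm _).mpr (hg u v)) (fun u ↦ (hm _).mpr (hg x u)) hz inf_le_left
    (fun u ↦ ?_) hM (fun h0 ↦ ?_) ha
  · rw [hm]
    exact ⟨fun hu ↦ hu.2, fun hu ↦ ⟨u.2, hu⟩⟩
  -- If `l [x, z]` vanished, `z` would be orthogonal to `x` and to the isotropic `ker f`, so it
  -- would lie in the radical, where `g` vanishes; but `m z = 1`.
  · have h1 : g' z = 0 := by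
      refine h z fun v ↦ ?_
      have h2 := hl (kerPart (hf := hf) hx v) (kerPart hx v).2 z z.2
      change l ⁅v - f v • x, (z : L)⁆ = 0 at h2
      rwa [sub_lie, smul_lie, map_sub, map_smul, h0, smul_zero, sub_zero] at h2
    rw [← hm, hz] at h1
    exact one_ne_zero h1

variable [LieRing.IsNilpotent L]

/-- Exchange `B ∩ ker f` and `y` for `B`. The old and new subalgebras lie in the pure closure `H` of
`B + O y`: if `H` is proper, `ih` applies in a kernel containing `H`; if `H = L`, both have corank
one and the Heisenberg case applies to each. -/
theorem IsReducing.exists_isLagrangian {l : L →ₗ[O] O} {k N : LieIdeal O L} {y : L}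
    (h : IsReducing l k N y)
    (ih : ∀ (f : L →ₗ[O] O) (hf : ∀ x y : L, f ⁅x, y⁆ = 0) (x : L) (_ : f x = 1)
      (B B' : LieSubalgebra O L) (_ : IsLagrangian l B) (_ : IsLagrangian l B')
      (_ : B ≤ kerSubalgebra f hf) (_ : B' ≤ kerSubalgebra f hf)
      (a : ℕ → UniversalEnvelopingAlgebra O L) (_ : IsCompatible (maximalIdeal O) a),
      Annihilates (maximalIdeal O) l B a ↔ Annihilates (maximalIdeal O) l B' a)
    {f : L →ₗ[O] O} {hf : ∀ x y : L, f ⁅x, y⁆ = 0} {x₀ : L} (hx₀ : f x₀ = 1)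
    (hfy : ∀ u, f u = 0 ↔ l ⁅u, y⁆ = 0) {B : LieSubalgebra O L} (hB : IsLagrangian l B) :
    ∃ B', IsLagrangian l B' ∧ B' ≤ kerSubalgebra f hf ∧
      ∀ a, IsCompatible (maximalIdeal O) a →
        (Annihilates (maximalIdeal O) l B a ↔ Annihilates (maximalIdeal O) l B' a) := by
  by_cases hBf : B ≤ kerSubalgebra f hf
  · exact ⟨B, hB, hBf, fun _ _ ↦ Iff.rfl⟩
  obtain ⟨x, hx, hxf⟩ := SetLike.not_le_iff_exists.mp hBf
  have hxy : l ⁅x, y⁆ ≠ 0 := fun h0 ↦ hxf ((hfy x).mpr h0)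
  have hyx : l ⁅y, x⁆ ≠ 0 := by rwa [← lie_skew, map_neg, neg_ne_zero]
  set B' := adjoinElement (B ⊓ kerSubalgebra f hf) y (h.lie_mem_inf hB f hf)
  have hB' : IsLagrangian l B' := h.isLagrangian_adjoinElement hB hfy hx hxy
  have hB'f : B' ≤ kerSubalgebra f hf := fun u hu ↦
    (hfy u).mpr (hB'.lie_eq_zero hu mem_adjoinElement_self)
  refine ⟨B', hB', hB'f, fun a ha ↦ ?_⟩
  let H := adjoinElement B y fun c _ ↦ h.lie_mem_lagrangian hB c
  have hB'H : B' ≤ H := by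
    intro u hu
    obtain ⟨t, ht, c, hc, s, hu⟩ := mem_adjoinElement.mp hu
    exact mem_adjoinElement.mpr ⟨t, ht, c, hc.1, s, hu⟩
  by_cases hH : H = ⊤
  swap
  · obtain ⟨f', hf', hH', x', hx'⟩ := exists_form_of_ne_top isolator_adjoinElement hH
    exact ih f' hf' x' hx' B B' hB hB' (fun u hu ↦ hH' u (le_adjoinElement hu))
      (fun u hu ↦ hH' u (hB'H hu)) a ha
  have hall (u : L) : ∃ t : O, t ≠ 0 ∧ ∃ c ∈ B, ∃ s : O, t • u = c + s • y :=
    mem_adjoinElement.mp (hH ▸ LieSubalgebra.mem_top u : u ∈ H)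
  -- Since `L` is `B + O y` up to torsion and `l [y, x] ≠ 0`, orthogonality to `x` alone already
  -- cuts out `B`.
  have hBx (u : L) : u ∈ B ↔ l ⁅u, x⁆ = 0 := by
    refine ⟨fun hu ↦ hB.lie_eq_zero hu hx, fun hu ↦ ?_⟩
    obtain ⟨t, ht, c, hc, s, e⟩ := hall u
    have h1 := congrArg (fun v ↦ l ⁅v, x⁆) e
    simp only [smul_lie, add_lie, map_smul, map_add, hu, hB.lie_eq_zero hc hx, smul_eq_mul,
      mul_zero, zero_add] at h1
    rw [(mul_eq_zero.mp h1.symm).resolve_right hyx, zero_smul, add_zero] at e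
    exact hB.mem_of_smul_mem ht (e ▸ hc)
  have hLB (u v : L) : ⁅u, v⁆ ∈ B := by
    obtain ⟨t, ht, c, hc, s, e⟩ := hall u
    obtain ⟨t', ht', c', hc', s', e'⟩ := hall v
    refine hB.mem_of_smul_mem (mul_ne_zero ht ht') ?_
    have e2 : (t * t') • ⁅u, v⁆ = ⁅c, c'⁆ + s' • ⁅c, y⁆ - s • ⁅c', y⁆ := by
      rw [mul_smul, ← lie_smul, ← smul_lie, e, e', add_lie, lie_add, lie_add, smul_lie,
        lie_smul, lie_smul, smul_lie, lie_self, ← lie_skew c' y, smul_zero, smul_zero, smul_neg, add_zero]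
      abel
    rw [e2]
    exact B.sub_mem (B.add_mem (B.lie_mem hc hc') (B.smul_mem _ (h.lie_mem_lagrangian hB c)))
      (B.smul_mem _ (h.lie_mem_lagrangian hB c'))
  obtain ⟨g, hg, x₁, hx₁⟩ := exists_form_ker_eq (f := bracketForm l x)
    fun h0 ↦ hyx (DFunLike.congr_fun h0 y)
  have hgB (u : L) : g u = 0 ↔ u ∈ B := by rw [hg, hBx]; rfl
  have hg' (u v : L) : g ⁅u, v⁆ = 0 := (hgB _).mpr (hLB u v)
  have hBg : B = kerSubalgebra g hg' := LieSubalgebra.ext _ _ fun u ↦ (hgB u).symm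
  have hB'f' : B' = kerSubalgebra f hf := by
    refine le_antisymm hB'f fun u hu ↦ ?_
    obtain ⟨t, ht, c, hc, s, e⟩ := hall u
    refine mem_adjoinElement.mpr ⟨t, ht, c, ⟨hc, (hfy c).mpr ?_⟩, s, e⟩
    have h1 := congrArg (fun v ↦ l ⁅v, y⁆) e
    simpa only [smul_lie, add_lie, map_smul, map_add, (hfy u).mp hu, lie_self, map_zero,
      smul_zero, add_zero, eq_comm] using h1
  -- `B ∩ ker f` is orthogonal to `B` and to `y`, hence to `L`.
  have hM (u c : L) (hcB : c ∈ B) (hcf : f c = 0) : l ⁅u, c⁆ = 0 := by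
    obtain ⟨t, ht, b, hb, s, e⟩ := hall u
    have h1 := congrArg (fun v ↦ l ⁅v, c⁆) e
    have h2 : l ⁅y, c⁆ = 0 := by rw [← lie_skew, map_neg, (hfy c).mp hcf, neg_zero]
    simp only [smul_lie, add_lie, map_smul, map_add, hB.lie_eq_zero hb hcB, h2,
      smul_eq_mul, mul_zero, add_zero] at h1
    exact (mul_eq_zero.mp h1).resolve_left ht
  rw [hBg, hB'f']
  rw [hBg] at hB
  rw [hB'f'] at hB'
  -- With `B = ker g` and `B' = ker f`, apply the Heisenberg case twice with the two forms
  -- exchanged; both conditions become the same one on the intersection.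
  rw [annihilates_iff_of_forms (hg := hf) (fun u hu v hv ↦ hB.lie_eq_zero hu hv)
      (fun u w hw ↦ hM u w (hBg ▸ hw.1) hw.2) hx₁ ((hgB x).mpr hx) hxf
      (fun u hu ↦ (hfy u).mpr (by rw [← lie_skew, map_neg, hu, neg_zero])) ha,
    annihilates_iff_of_forms (hg := hg') (fun u hu v hv ↦ hB'.lie_eq_zero hu hv)
      (fun u w hw ↦ hM u w (hBg ▸ hw.2) hw.1) hx₀ ((hfy y).mpr (by simp))
      (fun h0 ↦ hyx ((hg y).mp h0))
      (fun u hu ↦ (hg u).mpr (by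
        change l ⁅u, x⁆ = 0
        rw [← lie_skew, map_neg, hu, neg_zero])) ha, inf_comm]

theorem annihilates_iff_of_isLagrangian_aux (d : ℕ) : ∀ (L : Type*) [LieRing L] [LieAlgebra O L]
    [Module.Finite O L] [Module.IsTorsionFree O L] [LieRing.IsNilpotent L]
    (_ : Module.finrank O L = d) (l : L →ₗ[O] O) (B B' : LieSubalgebra O L)
    (_ : IsLagrangian l B) (_ : IsLagrangian l B')
    (a : ℕ → UniversalEnvelopingAlgebra O L) (_ : IsCompatible (maximalIdeal O) a),
    Annihilates (maximalIdeal O) l B a ↔ Annihilates (maximalIdeal O) l B' a := by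
  induction d using Nat.strong_induction_on with
  | _ d ih =>
    intro L _ _ _ _ _ hd l B₁ B₂ hB₁ hB₂ a ha
    -- Two Lagrangians in the same kernel are compared there: coefficients of compatible sequences
    -- are again compatible, and the rank has dropped.
    have ih' : ∀ (f : L →ₗ[O] O) (hf : ∀ x y : L, f ⁅x, y⁆ = 0) (x : L) (_ : f x = 1)
        (B B' : LieSubalgebra O L) (_ : IsLagrangian l B) (_ : IsLagrangian l B')
        (_ : B ≤ kerSubalgebra f hf) (_ : B' ≤ kerSubalgebra f hf)
        (a : ℕ → UniversalEnvelopingAlgebra O L) (_ : IsCompatible (maximalIdeal O) a),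
        Annihilates (maximalIdeal O) l B a ↔ Annihilates (maximalIdeal O) l B' a := by
      intro f hf x hx B B' hB hB' hBf hBf' a ha
      rw [annihilates_iff_coefficients hx hBf, annihilates_iff_coefficients hx hBf']
      refine forall_congr' fun v ↦ forall_congr' fun i ↦ ?_
      exact ih _ (hd ▸ finrank_ker_lt hx) _ rfl _ _ _ (hB.comap hBf) (hB'.comap hBf') _
        ((ha.mul_right v).map (Finsupp.lapply i ∘ₗ coefficients (hf := hf) hx))
    by_cases hl : ∃ u v : L, l ⁅u, v⁆ ≠ 0
    · obtain ⟨k, N, y, h⟩ := exists_isReducing hl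
      obtain ⟨f, hf, x₀, hx₀⟩ := exists_form_ker_eq (f := bracketForm l y) fun h0 ↦ by
        obtain ⟨u, hu⟩ := h.exists_ne
        exact hu (DFunLike.congr_fun h0 u)
      have hf' (u v : L) : f ⁅u, v⁆ = 0 := (hf _).mpr (h.lie_lie_eq_zero u v)
      obtain ⟨C₁, hC₁, hCf₁, h₁⟩ := h.exists_isLagrangian ih' (hf := hf') hx₀ hf hB₁
      obtain ⟨C₂, hC₂, hCf₂, h₂⟩ := h.exists_isLagrangian ih' (hf := hf') hx₀ hf hB₂
      rw [h₁ a ha, h₂ a ha]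
      exact ih' f hf' x₀ hx₀ C₁ C₂ hC₁ hC₂ hCf₁ hCf₂ a ha
    · push Not at hl
      have : B₁ = B₂ := LieSubalgebra.ext _ _ fun u ↦
        ⟨fun _ ↦ (hB₂ u).mpr fun w _ ↦ hl u w, fun _ ↦ (hB₁ u).mpr fun w _ ↦ hl u w⟩
      rw [this]

/-- The compatible sequences annihilating the module attached to a Lagrangian subalgebra do not
depend on it. -/
theorem annihilates_iff_of_isLagrangian [Module.IsTorsionFree O L] {l : L →ₗ[O] O} {B B' : LieSubalgebra O L}
    (hB : IsLagrangian l B) (hB' : IsLagrangian l B') {a : ℕ → UniversalEnvelopingAlgebra O L}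
    (ha : IsCompatible (maximalIdeal O) a) :
    Annihilates (maximalIdeal O) l B a ↔ Annihilates (maximalIdeal O) l B' a :=
  annihilates_iff_of_isLagrangian_aux _ L rfl l B B' hB hB' a ha

end Independence

/-! ### Elements of the completion as compatible sequences -/

section CompletionElements

variable {O : Type*} [CommRing O] {J : Ideal O} {A : Type*} [Ring A] [Algebra O A]

variable (J A) in
/-- The canonical homomorphism from an algebra to its completion. -/
def toCompletion : A →ₐ[O] completion J A where
  toFun a := ⟨fun _ ↦ Ideal.Quotient.mk _ a, fun _ _ _ ↦ rfl⟩
  map_one' := rfl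
  map_zero' := rfl
  map_mul' _ _ := rfl
  map_add' _ _ := rfl
  commutes' _ := rfl

/-- The element of the completion given by a compatible sequence. -/
def ofCompatible (a : ℕ → A) (ha : IsCompatible J a) : completion J A :=
  ⟨fun n ↦ Ideal.Quotient.mk _ (a n), fun m n h ↦ by
    obtain ⟨k, rfl⟩ := Nat.exists_eq_add_of_le h
    exact (Ideal.Quotient.mk_eq_mk_iff_sub_mem _ _).mpr (ha.sub_mem m k)⟩

/-- The compatible sequence `a` represents the element `x` of the completion. -/
def Represents (a : ℕ → A) (x : completion J A) : Prop :=
  ∀ n, Ideal.Quotient.mk (powIdeal J A n) (a n) = x.1 n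

theorem exists_represents (x : completion J A) : ∃ a : ℕ → A, Represents a x := by
  choose a ha using fun n ↦ Ideal.Quotient.mk_surjective (x.1 n)
  exact ⟨a, ha⟩

namespace Represents

variable {a b : ℕ → A} {x y : completion J A}

theorem isCompatible (h : Represents a x) : IsCompatible J a := fun n ↦ by
  rw [← Ideal.Quotient.mk_eq_mk_iff_sub_mem, h n, ← x.2 n.le_succ, ← h (n + 1)]
  rfl

theorem mul (ha : Represents a x) (hb : Represents b y) :
    Represents (fun n ↦ a n * b n) (x * y) := fun n ↦ by
  rw [map_mul, ha, hb]
  rfl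

theorem sub (ha : Represents a x) (hb : Represents b y) :
    Represents (fun n ↦ a n - b n) (x - y) := fun n ↦ by
  rw [map_sub, ha, hb]
  rfl

theorem add (ha : Represents a x) (hb : Represents b y) :
    Represents (fun n ↦ a n + b n) (x + y) := fun n ↦ by
  rw [map_add, ha, hb]
  rfl

theorem smul (ha : Represents a x) (r : O) : Represents (fun n ↦ r • a n) (r • x) := fun n ↦ by
  change Ideal.Quotient.mk _ _ = r • x.1 n
  rw [← ha]
  rfl

theorem ext (ha : Represents a x) (hb : Represents b y) (h : ∀ n, a n - b n ∈ powIdeal J A n) :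
    x = y :=
  Subtype.ext <| funext fun n ↦ by
    rw [← ha, ← hb, Ideal.Quotient.mk_eq_mk_iff_sub_mem]
    exact h n

theorem sub_mem (ha : Represents a x) (hb : Represents b x) (n : ℕ) :
    a n - b n ∈ powIdeal J A n := by
  rw [← Ideal.Quotient.mk_eq_mk_iff_sub_mem, ha, hb]

end Represents

theorem represents_ofCompatible (a : ℕ → A) (ha : IsCompatible J a) :
    Represents a (ofCompatible a ha) := fun _ ↦ rfl

theorem represents_toCompletion (u : A) : Represents (fun _ ↦ u) (toCompletion J A u) :=
  fun _ ↦ rfl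

theorem Represents.completionMap {A' : Type*} [Ring A'] [Algebra O A'] (φ : A →ₐ[O] A')
    {a : ℕ → A} {x : completion J A} (h : Represents a x) :
    Represents (fun n ↦ φ (a n)) (completionMap J φ x) := fun n ↦ by
  change Ideal.Quotient.mk _ _ = quotientMap J φ n (x.1 n)
  rw [← h]
  rfl

theorem Represents.completionCharacter_sub_mem [IsAdicComplete J O] (φ : A →ₐ[O] O)
    {a : ℕ → A} {x : completion J A} (h : Represents a x) (n : ℕ) :
    φ (a n) - completionCharacter J φ x ∈ J ^ n := by
  rw [← Ideal.Quotient.mk_eq_mk_iff_sub_mem]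
  have h1 : Ideal.Quotient.mk (J ^ n) (completionCharacter J φ x) = evalCharacter J φ n x :=
    IsAdicComplete.mk_liftRingHom J
      (fun n ↦ (evalCharacter J φ n : completion J A →+* O ⧸ J ^ n))
      (fun h ↦ RingHom.ext (factor_evalCharacter J φ h)) n x
  rw [h1]
  change _ = Ideal.Quotient.factorₐ O (powIdeal_self J n).le (quotientMap J φ n (x.1 n))
  rw [← h]
  rfl

end CompletionElements

/-! ### Saturation and generators of the closed left ideal -/

section ClosedIdeal

variable {O : Type*} [CommRing O] {L : Type*} [LieRing L] [LieAlgebra O L]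

/-- The closure in the completion of the left ideal attached to a subalgebra. -/
def closedIdeal (J : Ideal O) (l : L →ₗ[O] O) (B : LieSubalgebra O L) :
    Ideal (completion J (UniversalEnvelopingAlgebra O L)) where
  carrier := {x | ∀ a, Represents a x → ∀ n, a n ∈ approxIdeal J l B n}
  zero_mem' a ha n := by
    have h : Represents (fun _ ↦ 0) (0 : completion J (UniversalEnvelopingAlgebra O L)) :=
      fun _ ↦ rfl
    have h1 := ha.sub_mem h n
    rw [sub_zero] at h1
    exact Submodule.mem_sup_right h1
  add_mem' {x y} hx hy c hc n := by
    obtain ⟨a, ha⟩ := exists_represents x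
    obtain ⟨b, hb⟩ := exists_represents y
    have h := (approxIdeal J l B n).add_mem (Submodule.mem_sup_right (hc.sub_mem (ha.add hb) n))
      ((approxIdeal J l B n).add_mem (hx a ha n) (hy b hb n))
    simpa using h
  smul_mem' x y hy c hc n := by
    obtain ⟨a, ha⟩ := exists_represents x
    obtain ⟨b, hb⟩ := exists_represents y
    have h := (approxIdeal J l B n).add_mem (Submodule.mem_sup_right (hc.sub_mem (ha.mul hb) n))
      ((approxIdeal J l B n).mul_mem_left (a n) (hy b hb n))
    simpa using h

variable {J : Ideal O} {l : L →ₗ[O] O} {B : LieSubalgebra O L}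

theorem Represents.mem_closedIdeal_iff {a : ℕ → UniversalEnvelopingAlgebra O L}
    {x : completion J (UniversalEnvelopingAlgebra O L)} (ha : Represents a x) :
    x ∈ closedIdeal J l B ↔ ∀ n, a n ∈ approxIdeal J l B n := by
  refine ⟨fun h ↦ h a ha, fun h b hb n ↦ ?_⟩
  simpa using (approxIdeal J l B n).add_mem (Submodule.mem_sup_right (hb.sub_mem ha n)) (h n)

/-- Multipliers from `U(L)` suffice, since modulo `J ^ n` each element of the completion is
represented by one of `U(L)`. -/
theorem Represents.forall_mul_mem_closedIdeal_iff {a : ℕ → UniversalEnvelopingAlgebra O L}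
    {x : completion J (UniversalEnvelopingAlgebra O L)} (ha : Represents a x) :
    (∀ y, x * y ∈ closedIdeal J l B) ↔ Annihilates J l B a := by
  constructor
  · intro h n v
    exact (ha.mul (represents_toCompletion v)).mem_closedIdeal_iff.mp (h _) n
  · intro h y
    obtain ⟨b, hb⟩ := exists_represents y
    exact (ha.mul hb).mem_closedIdeal_iff.mpr fun n ↦ h n (b n)

variable [IsDomain O] [IsDiscreteValuationRing O] [Module.Finite O L]

/-- Finitely many generators allow infinitely many corrections to be collected into finitely many
convergent series in `closedIdeal_le_span`. -/
theorem exists_characterIdeal_eq_span (l : L →ₗ[O] O) (B : LieSubalgebra O L) :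
    ∃ (m : ℕ) (w : Fin m → L), (∀ j, w j ∈ B) ∧ characterIdeal l B =
      Ideal.span (Set.range fun j ↦ UniversalEnvelopingAlgebra.ι O (w j) -
        algebraMap O _ (l (w j))) := by
  obtain ⟨m, w, hw⟩ := Submodule.fg_iff_exists_fin_generating_family.mp
    (IsNoetherian.noetherian B.toSubmodule)
  have hwB j : w j ∈ B := by
    rw [← LieSubalgebra.mem_toSubmodule, ← hw]
    exact Submodule.subset_span ⟨j, rfl⟩
  refine ⟨m, w, hwB, le_antisymm (Ideal.span_le.mpr ?_) (Ideal.span_le.mpr ?_)⟩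
  · rintro _ ⟨v, hv, rfl⟩
    rw [SetLike.mem_coe, ← LieSubalgebra.mem_toSubmodule, ← hw] at hv
    refine Submodule.span_induction (p := fun v _ ↦ UniversalEnvelopingAlgebra.ι O v -
      algebraMap O _ (l v) ∈ Ideal.span (Set.range fun j ↦ UniversalEnvelopingAlgebra.ι O (w j) -
        algebraMap O _ (l (w j)))) ?_ ?_ ?_ ?_ hv
    · rintro _ ⟨j, rfl⟩
      exact Ideal.subset_span ⟨j, rfl⟩
    · simp only [map_zero, sub_zero, Ideal.zero_mem]
    · intro u v _ _ hu hv
      rw [map_add, map_add, map_add, add_sub_add_comm]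
      exact Ideal.add_mem _ hu hv
    · intro r u _ hu
      rw [map_smul, map_smul, smul_eq_mul, map_mul, ← Algebra.smul_def, ← smul_sub,
        Algebra.smul_def]
      exact Ideal.mul_mem_left _ _ hu
  · rintro _ ⟨j, rfl⟩
    exact sub_mem_characterIdeal (hwB j)

variable [Module.IsTorsionFree O L] [LieRing.IsNilpotent L]

theorem eq_zero_of_smul_eq_zero {r : O} (hr : r ≠ 0) {u : UniversalEnvelopingAlgebra O L}
    (hu : r • u = 0) : u = 0 := by
  -- Torsion-freeness of `U(L)` is the case of the zero subalgebra.
  have h0 : characterIdeal (0 : L →ₗ[O] O) ⊥ = ⊥ := by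
    refine (Ideal.span_eq_bot).mpr ?_
    rintro _ ⟨w, hw, rfl⟩
    rw [SetLike.mem_coe, LieSubalgebra.mem_bot] at hw
    simp only [hw, map_zero, sub_zero]
  have hB : isolator (⊥ : LieSubalgebra O L).toSubmodule = (⊥ : LieSubalgebra O L).toSubmodule := by
    refine le_antisymm ?_ (le_isolator _)
    rintro u ⟨t, ht, hu⟩
    change t • u = 0 at hu
    exact (smul_eq_zero.mp hu).resolve_left ht
  have h1 := mem_of_smul_mem_characterIdeal (l := 0) (B := ⊥) hB (by simp) hr (u := u)
    (by rw [hu]; exact Ideal.zero_mem _)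
  rw [h0] at h1
  exact h1

theorem exists_smul_of_mem_powIdeal_one {π : O} (hπ : Irreducible π)
    {x : completion (maximalIdeal O) (UniversalEnvelopingAlgebra O L)}
    {a : ℕ → UniversalEnvelopingAlgebra O L} (ha : Represents a x)
    (h : a 1 ∈ powIdeal (maximalIdeal O) (UniversalEnvelopingAlgebra O L) 1) :
    ∃ y, x = π • y := by
  have h1 n : ∃ w, a (n + 1) = π • w := by
    have h2 := Ideal.add_mem _ (ha.isCompatible.sub_mem 1 n) h
    rw [sub_add_cancel, mem_powIdeal_iff hπ.maximalIdeal_eq, pow_one, add_comm] at h2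
    exact h2
  choose b hb using h1
  have hc : IsCompatible (maximalIdeal O) b := fun n ↦ by
    obtain ⟨w, hw⟩ := (mem_powIdeal_iff hπ.maximalIdeal_eq).mp (ha.isCompatible (n + 1))
    rw [hb, hb, ← smul_sub, pow_succ', mul_smul, ← sub_eq_zero, ← smul_sub] at hw
    exact (mem_powIdeal_iff hπ.maximalIdeal_eq).mpr
      ⟨w, sub_eq_zero.mp (eq_zero_of_smul_eq_zero hπ.ne_zero hw)⟩
  refine ⟨ofCompatible b hc, ha.ext ((represents_ofCompatible b hc).smul π) fun n ↦ ?_⟩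
  rw [← hb, ← neg_sub]
  exact neg_mem (ha.isCompatible n)

/-- If `r` is `π ^ e` up to a unit, look at the term of index `n + e`: its error is divisible by `r`
with quotient in `π ^ n U(L)`, and torsion-freeness of the cyclic module removes `r` from the rest.
-/
theorem mem_closedIdeal_of_smul_mem (hB : isolator B.toSubmodule = B.toSubmodule)
    (hl : ∀ x ∈ B, ∀ y ∈ B, l ⁅x, y⁆ = 0) {r : O} (hr : r ≠ 0)
    {x : completion (maximalIdeal O) (UniversalEnvelopingAlgebra O L)}
    (hx : r • x ∈ closedIdeal (maximalIdeal O) l B) : x ∈ closedIdeal (maximalIdeal O) l B := by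
  obtain ⟨π, hπ⟩ := IsDiscreteValuationRing.exists_irreducible O
  obtain ⟨e, ε, he⟩ := IsDiscreteValuationRing.associated_pow_irreducible hr hπ
  obtain ⟨a, ha⟩ := exists_represents x
  rw [ha.mem_closedIdeal_iff]
  intro n
  have h1 := (ha.smul r).mem_closedIdeal_iff.mp hx (n + e)
  obtain ⟨i, hi, z, hz, h1⟩ := Submodule.mem_sup.mp h1
  obtain ⟨w, rfl⟩ := (mem_powIdeal_iff hπ.maximalIdeal_eq).mp hz
  have h2 : r • (a (n + e) - ((ε : O) * π ^ n) • w) = i := by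
    rw [smul_sub, ← h1, ← mul_smul, ← mul_assoc, he, ← pow_add, add_comm e n, add_sub_cancel_right]
  have h3 : a (n + e) - ((ε : O) * π ^ n) • w ∈ characterIdeal l B :=
    mem_of_smul_mem_characterIdeal hB hl hr (h2 ▸ hi)
  have h4 : ((ε : O) * π ^ n) • w - (a (n + e) - a n) ∈
      powIdeal (maximalIdeal O) (UniversalEnvelopingAlgebra O L) n := by
    refine Ideal.sub_mem _ ((mem_powIdeal_iff hπ.maximalIdeal_eq).mpr ⟨(ε : O) • w, ?_⟩)
      (ha.isCompatible.sub_mem n e)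
    rw [smul_smul, mul_comm]
  have h5 := Submodule.add_mem_sup h3 h4
  rw [show a (n + e) - ((ε : O) * π ^ n) • w + (((ε : O) * π ^ n) • w - (a (n + e) - a n)) = a n by
    abel] at h5
  exact h5

/-- The closed left ideal attached to a subalgebra is generated by the obvious elements. -/
theorem closedIdeal_le_span (hB : isolator B.toSubmodule = B.toSubmodule)
    (hl : ∀ x ∈ B, ∀ y ∈ B, l ⁅x, y⁆ = 0) :
    closedIdeal (maximalIdeal O) l B ≤ Ideal.span ((fun w ↦ toCompletion (maximalIdeal O) _
      (UniversalEnvelopingAlgebra.ι O w - algebraMap O _ (l w))) '' B) := by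
  obtain ⟨π, hπ⟩ := IsDiscreteValuationRing.exists_irreducible O
  obtain ⟨m, w, hw, hI⟩ := exists_characterIdeal_eq_span l B
  set z : Fin m → UniversalEnvelopingAlgebra O L := fun j ↦
    UniversalEnvelopingAlgebra.ι O (w j) - algebraMap O _ (l (w j))
  have hle (u : UniversalEnvelopingAlgebra O L) (hu : u ∈ characterIdeal l B) :
      toCompletion (maximalIdeal O) _ u ∈ closedIdeal (maximalIdeal O) l B :=
    (represents_toCompletion u).mem_closedIdeal_iff.mpr fun n ↦ Submodule.mem_sup_left hu
  -- One approximation step: modulo `π`, `x` is a combination of the generators, and the remainder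
  -- divided by `π` stays in the closed ideal by saturation.
  have hstep (x : closedIdeal (maximalIdeal O) l B) :
      ∃ (c : Fin m → UniversalEnvelopingAlgebra O L) (y : closedIdeal (maximalIdeal O) l B),
        (x : completion (maximalIdeal O) (UniversalEnvelopingAlgebra O L)) =
          toCompletion (maximalIdeal O) _ (∑ j, c j * z j) + π • (y : completion _ _) := by
    obtain ⟨a, ha⟩ := exists_represents (x : completion (maximalIdeal O)
      (UniversalEnvelopingAlgebra O L))
    obtain ⟨i, hi, d, hd, h1⟩ := Submodule.mem_sup.mp (ha.mem_closedIdeal_iff.mp x.2 1)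
    obtain ⟨c, hc⟩ := (Submodule.mem_span_range_iff_exists_fun _).mp (hI ▸ hi)
    have hr := ha.sub (represents_toCompletion i)
    obtain ⟨y, hy⟩ := exists_smul_of_mem_powIdeal_one hπ hr (by
      rw [← h1, add_sub_cancel_left]
      exact hd)
    have hy' : y ∈ closedIdeal (maximalIdeal O) l B := by
      refine mem_closedIdeal_of_smul_mem hB hl hπ.ne_zero ?_
      rw [← hy]
      exact Ideal.sub_mem _ x.2 (hle i hi)
    refine ⟨c, ⟨y, hy'⟩, ?_⟩
    rw [← hy, add_comm, show ∑ j, c j * z j = i from hc, sub_add_cancel]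
  intro x hx
  choose c y hy using hstep
  let s : ℕ → closedIdeal (maximalIdeal O) l B := fun k ↦ y^[k] ⟨x, hx⟩
  have hs k : (s k : completion (maximalIdeal O) (UniversalEnvelopingAlgebra O L)) =
      toCompletion (maximalIdeal O) _ (∑ j, c (s k) j * z j) + π • (s (k + 1) : completion _ _) := by
    rw [hy (s k)]
    congr 3
    exact (Function.iterate_succ_apply' y k _).symm
  -- Partial sums of the series of corrections to the `j`-th coefficient; consecutive ones differ by
  -- a multiple of `π ^ n`.
  let b (j : Fin m) (n : ℕ) : UniversalEnvelopingAlgebra O L :=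
    ∑ k ∈ Finset.range n, π ^ k • c (s k) j
  have hb j : IsCompatible (maximalIdeal O) (b j) := fun n ↦ by
    simp only [b]
    rw [Finset.sum_range_succ, add_sub_cancel_left, mem_powIdeal_iff hπ.maximalIdeal_eq]
    exact ⟨_, rfl⟩
  have hsum n : x = toCompletion (maximalIdeal O) _ (∑ j, b j n * z j) +
      π ^ n • (s n : completion _ _) := by
    induction n with
    | zero => simp [b, s]
    | succ n hn =>
      have e : ∑ j, b j (n + 1) * z j = ∑ j, b j n * z j + π ^ n • ∑ j, c (s n) j * z j := by
        simp only [b, Finset.sum_range_succ, add_mul, Finset.sum_add_distrib, smul_mul_assoc,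
          Finset.smul_sum]
      rw [e, map_add, map_smul, pow_succ, mul_smul, add_assoc, ← smul_add, ← hs]
      exact hn
  have hx' : x = ∑ j, ofCompatible (b j) (hb j) * toCompletion (maximalIdeal O) _ (z j) := by
    refine Subtype.ext (funext fun n ↦ ?_)
    let ev := (Pi.evalAlgHom O (fun n ↦ UniversalEnvelopingAlgebra O L ⧸
      powIdeal (maximalIdeal O) (UniversalEnvelopingAlgebra O L) n) n).comp
      (completion (maximalIdeal O) (UniversalEnvelopingAlgebra O L)).val
    have h0 : π ^ n • ev (s n) = 0 := by
      obtain ⟨u, hu⟩ := Ideal.Quotient.mk_surjective (ev (s n))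
      rw [← hu]
      exact Ideal.Quotient.eq_zero_iff_mem.mpr
        ((mem_powIdeal_iff hπ.maximalIdeal_eq).mpr ⟨u, rfl⟩)
    have h1 : ev x = ∑ j, ev (ofCompatible (b j) (hb j)) * ev (toCompletion _ _ (z j)) := by
      rw [hsum n, map_add, map_smul, h0, add_zero, map_sum, map_sum]
      refine Finset.sum_congr rfl fun j _ ↦ ?_
      rw [map_mul, map_mul]
      rfl
    change ev x = ev _
    rw [h1, map_sum]
    simp only [map_mul]
  rw [hx']
  exact Submodule.sum_mem _ fun j _ ↦ Ideal.mul_mem_left _ _ (Ideal.subset_span ⟨w j, hw j, rfl⟩)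

end ClosedIdeal

/-! ### Induced modules of characters as cyclic modules -/

section InducedCharacter

variable {S A F : Type*} [Ring S] [Ring A] [Field F] (φ : S →+* A) (χ : S →+* F)

/-- The identity map from the module attached to a character to the field. -/
def characterModuleVal : CharacterModule χ →+ F := AddMonoidHom.id F

theorem characterModuleVal_smul (s : S) (k : CharacterModule χ) :
    characterModuleVal χ (s • k) = χ s * characterModuleVal χ k := rfl

variable {φ χ}

theorem tmul_mem_balancedRelations {y : A} (hy : y ∈ Ideal.span (φ '' {s | χ s = 0}))
    (k : CharacterModule χ) : y ⊗ₜ k ∈ balancedRelations φ (CharacterModule χ) := by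
  suffices H : ∀ c : A, (c * y) ⊗ₜ k ∈ balancedRelations φ (CharacterModule χ) by
    simpa using H 1
  refine Submodule.span_induction
    (p := fun y _ ↦ ∀ c : A, (c * y) ⊗ₜ k ∈ balancedRelations φ (CharacterModule χ))
    ?_ ?_ ?_ ?_ hy
  · rintro _ ⟨s, hs, rfl⟩ c
    have h3 : s • k = 0 := by
      change χ s * characterModuleVal χ k = 0
      rw [show χ s = 0 from hs, zero_mul]
    have h4 : (c * φ s) ⊗ₜ[ℤ] k - c ⊗ₜ[ℤ] (s • k) ∈ balancedRelations φ (CharacterModule χ) :=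
      Submodule.subset_span ⟨c, s, k, rfl⟩
    rwa [h3, TensorProduct.tmul_zero, sub_zero] at h4
  · simp
  · intro a b _ _ ha hb c
    rw [mul_add, TensorProduct.add_tmul]
    exact Submodule.add_mem _ (ha c) (hb c)
  · intro b a _ ha c
    rw [smul_eq_mul, ← mul_assoc]
    exact ha _

variable (χ) [Algebra F A]

/-- The map to a cyclic module underlying the module induced from a character. -/
def tensorToQuotient (I : Ideal A) : A ⊗[ℤ] CharacterModule χ →ₗ[A] A ⧸ I :=
  TensorProduct.AlgebraTensorModule.lift
    { toFun := fun y ↦ AddMonoidHom.toIntLinearMap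
        ((I.mkQ.toAddMonoidHom.comp (AddMonoidHom.mulLeft y)).comp
          ((algebraMap F A : F →+ A).comp (characterModuleVal χ)))
      map_add' := fun y y' ↦ by
        ext k
        change I.mkQ ((y + y') * algebraMap F A (characterModuleVal χ k)) =
          I.mkQ (y * algebraMap F A (characterModuleVal χ k)) +
          I.mkQ (y' * algebraMap F A (characterModuleVal χ k))
        rw [add_mul, map_add]
      map_smul' := fun c y ↦ by
        ext k
        change I.mkQ (c • y * algebraMap F A (characterModuleVal χ k)) =
          c • I.mkQ (y * algebraMap F A (characterModuleVal χ k))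
        rw [smul_mul_assoc, map_smul] }

theorem tensorToQuotient_tmul (I : Ideal A) (y : A) (k : CharacterModule χ) :
    tensorToQuotient χ I (y ⊗ₜ k) = Submodule.Quotient.mk (y * algebraMap F A (characterModuleVal χ k)) := rfl

variable {χ}

theorem tensorToQuotient_eq_zero {I : Ideal A} (h : ∀ s, φ s - algebraMap F A (χ s) ∈ I)
    {y : A ⊗[ℤ] CharacterModule χ} (hy : y ∈ balancedRelations φ (CharacterModule χ)) :
    tensorToQuotient χ I y = 0 := by
  refine LinearMap.mem_ker.mp (Submodule.span_le.mpr ?_ hy)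
  rintro _ ⟨c, s, k, rfl⟩
  rw [SetLike.mem_coe, LinearMap.mem_ker, map_sub, tensorToQuotient_tmul, tensorToQuotient_tmul,
    ← Submodule.Quotient.mk_sub, Submodule.Quotient.mk_eq_zero]
  have e : c * φ s * algebraMap F A (characterModuleVal χ k) -
      c * algebraMap F A (characterModuleVal χ (s • k)) =
      (c * algebraMap F A (characterModuleVal χ k)) * (φ s - algebraMap F A (χ s)) := by
    rw [characterModuleVal_smul, mul_assoc, ← Algebra.commutes, mul_comm (χ s), map_mul, mul_sub,
      mul_assoc, mul_assoc]
  exact e ▸ Ideal.mul_mem_left _ _ (h s)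

/-- The annihilator of the module induced from a character. -/
theorem mem_annihilator_inducedModule_iff {I : Ideal A}
    (h : ∀ s, φ s - algebraMap F A (χ s) ∈ I) (h' : I ≤ Ideal.span (φ '' {s | χ s = 0})) (y : A) :
    y ∈ Module.annihilator A (InducedModule φ (CharacterModule χ)) ↔ ∀ c, y * c ∈ I := by
  rw [Module.mem_annihilator]
  constructor
  · intro hy c
    -- Test on the class of `c ⊗ 1`, which corresponds to `c` in `A / I`.
    have h1 := hy (Submodule.Quotient.mk (c ⊗ₜ[ℤ] (show CharacterModule χ from (1 : F))))
    rw [← Submodule.Quotient.mk_smul, Submodule.Quotient.mk_eq_zero] at h1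
    have h2 := tensorToQuotient_eq_zero h h1
    rw [TensorProduct.smul_tmul', smul_eq_mul, tensorToQuotient_tmul,
      Submodule.Quotient.mk_eq_zero] at h2
    change y * c * algebraMap F A 1 ∈ _ at h2
    rwa [map_one, mul_one] at h2
  · intro hy m
    obtain ⟨z, rfl⟩ := Submodule.Quotient.mk_surjective _ m
    rw [← Submodule.Quotient.mk_smul, Submodule.Quotient.mk_eq_zero]
    induction z using TensorProduct.induction_on with
    | zero => simp
    | tmul c k =>
      rw [TensorProduct.smul_tmul', smul_eq_mul]
      exact tmul_mem_balancedRelations (h' (hy c)) k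
    | add c d hc hd =>
      rw [smul_add]
      exact Submodule.add_mem _ hc hd

theorem annihilator_inducedModule_eq {S' : Type*} [Ring S'] {φ' : S' →+* A} {χ' : S' →+* F}
    {I I' : Ideal A} (h₁ : ∀ s, φ s - algebraMap F A (χ s) ∈ I)
    (h₂ : I ≤ Ideal.span (φ '' {s | χ s = 0})) (h₁' : ∀ s, φ' s - algebraMap F A (χ' s) ∈ I')
    (h₂' : I' ≤ Ideal.span (φ' '' {s | χ' s = 0}))
    (h : ∀ y, (∀ c, y * c ∈ I) ↔ ∀ c, y * c ∈ I') :
    Module.annihilator A (InducedModule φ (CharacterModule χ)) =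
      Module.annihilator A (InducedModule φ' (CharacterModule χ')) :=
  Ideal.ext fun y ↦ by
    rw [mem_annihilator_inducedModule_iff h₁ h₂, mem_annihilator_inducedModule_iff h₁' h₂', h]

end InducedCharacter

/-! ### Passage to the affinoid enveloping algebra -/

section AffinoidAnnihilator

variable {K : Type*} [Field K] {O : ValuationSubring K}
variable {L : Type*} [LieRing L] [LieAlgebra O L]

theorem exists_smul_eq_one_tmul (y : AffinoidEnvelope O L) :
    ∃ t : O, t ≠ 0 ∧ ∃ a, t • y = 1 ⊗ₜ[O] a := by
  induction y using TensorProduct.induction_on with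
  | zero => exact ⟨1, one_ne_zero, 0, by simp⟩
  | tmul k a =>
    obtain ⟨r, t, ht, rfl⟩ := IsFractionRing.div_surjective O k
    have ht' : algebraMap O K t ≠ 0 := by
      simpa using nonZeroDivisors.ne_zero ht
    refine ⟨t, nonZeroDivisors.ne_zero ht, r • a, ?_⟩
    rw [TensorProduct.smul_tmul', TensorProduct.tmul_smul, TensorProduct.smul_tmul',
      Algebra.smul_def, Algebra.smul_def, mul_div_cancel₀ _ ht', mul_one]
  | add x y hx hy =>
    obtain ⟨t, ht, a, hx⟩ := hx
    obtain ⟨s, hs, b, hy⟩ := hy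
    refine ⟨t * s, mul_ne_zero ht hs, s • a + t • b, ?_⟩
    rw [smul_add, mul_smul, mul_smul, hy, smul_comm, hx, TensorProduct.tmul_add,
      TensorProduct.tmul_smul, TensorProduct.tmul_smul]

theorem exists_smul_eq_zero_of_one_tmul_eq_zero
    {a : completion (maximalIdeal O) (UniversalEnvelopingAlgebra O L)}
    (h : (1 : K) ⊗ₜ[O] a = 0) : ∃ t : O, t ≠ 0 ∧ t • a = 0 := by
  obtain ⟨t, ht⟩ := (IsLocalizedModule.eq_zero_iff (nonZeroDivisors O)
    (TensorProduct.mk O K (completion (maximalIdeal O) (UniversalEnvelopingAlgebra O L)) 1)).mp h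
  exact ⟨t, nonZeroDivisors.ne_zero t.2, ht⟩

/-- The extension of a left ideal of the completion to the affinoid enveloping algebra. -/
def extendedIdeal (I : Ideal (completion (maximalIdeal O) (UniversalEnvelopingAlgebra O L))) :
    Ideal (AffinoidEnvelope O L) where
  carrier := {y | ∃ t : O, t ≠ 0 ∧ ∃ a ∈ I, t • y = 1 ⊗ₜ[O] a}
  zero_mem' := ⟨1, one_ne_zero, 0, I.zero_mem, by simp⟩
  add_mem' := by
    rintro x y ⟨t, ht, a, ha, hx⟩ ⟨s, hs, b, hb, hy⟩
    refine ⟨t * s, mul_ne_zero ht hs, s • a + t • b, I.add_mem ?_ ?_, ?_⟩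
    · rw [Algebra.smul_def]
      exact I.mul_mem_left _ ha
    · rw [Algebra.smul_def]
      exact I.mul_mem_left _ hb
    · rw [smul_add, mul_smul, mul_smul, hy, smul_comm, hx, TensorProduct.tmul_add,
        TensorProduct.tmul_smul, TensorProduct.tmul_smul]
  smul_mem' := by
    rintro x y ⟨t, ht, a, ha, hy⟩
    obtain ⟨s, hs, b, hx⟩ := exists_smul_eq_one_tmul x
    refine ⟨s * t, mul_ne_zero hs ht, b * a, I.mul_mem_left _ ha, ?_⟩
    rw [smul_eq_mul, mul_smul, ← mul_smul_comm, ← smul_mul_assoc, hx, hy,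
      Algebra.TensorProduct.tmul_mul_tmul, one_mul]

/-- Equality after tensoring with `K` holds up to a nonzero scalar of `O`, which saturation of `I`
removes. -/
theorem mem_of_one_tmul_mem_extendedIdeal
    {I : Ideal (completion (maximalIdeal O) (UniversalEnvelopingAlgebra O L))}
    (hI : ∀ t : O, t ≠ 0 → ∀ a, t • a ∈ I → a ∈ I)
    {a : completion (maximalIdeal O) (UniversalEnvelopingAlgebra O L)}
    (h : (1 : K) ⊗ₜ[O] a ∈ extendedIdeal I) : a ∈ I := by
  obtain ⟨t, ht, b, hb, h⟩ := h
  rw [← TensorProduct.tmul_smul, ← sub_eq_zero, ← TensorProduct.tmul_sub] at h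
  obtain ⟨s, hs, h⟩ := exists_smul_eq_zero_of_one_tmul_eq_zero h
  rw [smul_sub, sub_eq_zero] at h
  refine hI t ht _ (hI s hs _ ?_)
  rw [h, Algebra.smul_def]
  exact I.mul_mem_left _ hb

theorem smul_mem_iff {t : O} (ht : t ≠ 0) (I : Ideal (AffinoidEnvelope O L))
    (y : AffinoidEnvelope O L) : t • y ∈ I ↔ y ∈ I := by
  have ht' : algebraMap O K t ≠ 0 := by simpa using ht
  rw [← algebraMap_smul K t y]
  refine ⟨fun h ↦ ?_, fun h ↦ ?_⟩
  · rw [← one_smul K y, ← inv_mul_cancel₀ ht', mul_smul, Algebra.smul_def]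
    exact I.mul_mem_left _ h
  · rw [Algebra.smul_def]
    exact I.mul_mem_left _ h

theorem forall_mul_mem_extendedIdeal_iff
    {I : Ideal (completion (maximalIdeal O) (UniversalEnvelopingAlgebra O L))}
    (hI : ∀ t : O, t ≠ 0 → ∀ a, t • a ∈ I → a ∈ I) {y : AffinoidEnvelope O L} {t : O} (ht : t ≠ 0)
    {a : completion (maximalIdeal O) (UniversalEnvelopingAlgebra O L)} (hy : t • y = 1 ⊗ₜ[O] a) :
    (∀ c, y * c ∈ extendedIdeal I) ↔ ∀ b, a * b ∈ I := by
  constructor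
  · intro h b
    refine mem_of_one_tmul_mem_extendedIdeal hI ?_
    have h1 := (smul_mem_iff ht _ _).mpr (h (1 ⊗ₜ b))
    rwa [← smul_mul_assoc, hy, Algebra.TensorProduct.tmul_mul_tmul, one_mul] at h1
  · intro h c
    obtain ⟨s, hs, b, hb⟩ := exists_smul_eq_one_tmul c
    refine ⟨s * t, mul_ne_zero hs ht, a * b, h b, ?_⟩
    rw [mul_smul, ← smul_mul_assoc, ← mul_smul_comm, hb, hy, Algebra.TensorProduct.tmul_mul_tmul,
      one_mul]

variable {l : L →ₗ[O] O} {B : LieSubalgebra O L} {f : B →ₗ⁅O⁆ O}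

variable [IsAdicComplete (maximalIdeal O) O]

/-- Each term of a representing sequence is congruent to its character value modulo the left ideal,
and these values converge to the value of the completed character. -/
theorem completionMap_sub_mem_closedIdeal (hf : ∀ x : B, f x = l x)
    (s : completion (maximalIdeal O) (UniversalEnvelopingAlgebra O B)) :
    completionMap (maximalIdeal O) (envelopingIncl B) s -
      algebraMap O _ (completionCharacter (maximalIdeal O)
        (UniversalEnvelopingAlgebra.lift O f) s) ∈ closedIdeal (maximalIdeal O) l B := by
  obtain ⟨a, ha⟩ := exists_represents s
  set χ := UniversalEnvelopingAlgebra.lift O f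
  set c := completionCharacter (maximalIdeal O) χ s
  have h1 : Represents (fun _ ↦ algebraMap O (UniversalEnvelopingAlgebra O L) c)
      (algebraMap O (completion (maximalIdeal O) (UniversalEnvelopingAlgebra O L)) c) :=
    fun _ ↦ rfl
  rw [((ha.completionMap (envelopingIncl B)).sub h1).mem_closedIdeal_iff]
  intro n
  have h2 := sub_algebraMap_mem_characterIdeal (l.comp B.toSubmodule.subtype) χ
    (fun x ↦ (UniversalEnvelopingAlgebra.lift_ι_apply O f x).trans (hf x)) (a n)
  have h3 : envelopingIncl B (a n - algebraMap O _ (χ (a n))) ∈ characterIdeal l B := by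
    rw [← map_characterIdeal le_rfl]
    refine Ideal.mem_map_of_mem _ ?_
    convert h2
    ext x
    simp
  rw [map_sub, AlgHom.commutes] at h3
  have h4 := Submodule.add_mem_sup h3
    (Ideal.mem_map_of_mem (algebraMap O (UniversalEnvelopingAlgebra O L))
      (ha.completionCharacter_sub_mem χ n))
  rw [map_sub, sub_add_sub_cancel] at h4
  exact h4

theorem affinoidEnvelopeMap_sub_mem_extendedIdeal (hf : ∀ x : B, f x = l x)
    (s : AffinoidEnvelope O B) :
    affinoidEnvelopeMap O B.incl s - algebraMap K _ (affinoidEnvelopeCharacter O f s) ∈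
      extendedIdeal (closedIdeal (maximalIdeal O) l B) := by
  obtain ⟨t, ht, a, ha⟩ := exists_smul_eq_one_tmul s
  refine ⟨t, ht, _, completionMap_sub_mem_closedIdeal hf a, ?_⟩
  have h1 : t • affinoidEnvelopeMap O B.incl s =
      1 ⊗ₜ completionMap (maximalIdeal O) (envelopingIncl B) a := by
    change t • (affinoidEnvelopeMap O B.incl).restrictScalars O s = _
    rw [← map_smul, ha]
    rfl
  have h2 : t • affinoidEnvelopeCharacter O f s = algebraMap O K
      (completionCharacter (maximalIdeal O) (UniversalEnvelopingAlgebra.lift O f) a) := by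
    change t • (affinoidEnvelopeCharacter O f).restrictScalars O s = _
    rw [← map_smul, ha]
    change affinoidEnvelopeCharacter O f (1 ⊗ₜ a) = _
    rw [affinoidEnvelopeCharacter, Algebra.TensorProduct.lift_tmul, map_one, one_mul]
    rfl
  rw [smul_sub, h1, TensorProduct.tmul_sub]
  congr 1
  have h3 : t • algebraMap K (AffinoidEnvelope O L) (affinoidEnvelopeCharacter O f s) =
      algebraMap K (AffinoidEnvelope O L) (t • affinoidEnvelopeCharacter O f s) := by
    rw [Algebra.smul_def t (affinoidEnvelopeCharacter O f s), map_mul, Algebra.smul_def]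
    rfl
  rw [h3, h2, Algebra.TensorProduct.algebraMap_apply, Algebra.algebraMap_self_apply,
    Algebra.algebraMap_eq_smul_one, Algebra.algebraMap_eq_smul_one, TensorProduct.smul_tmul]

variable [IsDiscreteValuationRing O] [Module.Finite O L] [Module.IsTorsionFree O L]
  [LieRing.IsNilpotent L]

/-- After clearing denominators, the closed ideal is generated by the `w - l w`, which come from the
kernel of the character on the envelope of `B`. -/
theorem extendedIdeal_le_span (hf : ∀ x : B, f x = l x)
    (hB : isolator B.toSubmodule = B.toSubmodule) (hl : ∀ x ∈ B, ∀ y ∈ B, l ⁅x, y⁆ = 0) :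
    extendedIdeal (closedIdeal (maximalIdeal O) l B) ≤
      Ideal.span ((affinoidEnvelopeMap O B.incl).toRingHom ''
        {s | (affinoidEnvelopeCharacter O f).toRingHom s = 0}) := by
  rintro y ⟨t, ht, a, ha, h⟩
  rw [← smul_mem_iff ht, h]
  have h1 := Ideal.mem_map_of_mem (Algebra.TensorProduct.includeRight : _ →ₐ[O]
    AffinoidEnvelope O L) (closedIdeal_le_span hB hl ha)
  rw [Ideal.map_span, ← Set.image_comp] at h1
  refine Ideal.span_mono ?_ h1
  rintro _ ⟨w, hw, rfl⟩
  refine ⟨1 ⊗ₜ toCompletion (maximalIdeal O) _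
    (UniversalEnvelopingAlgebra.ι O (⟨w, hw⟩ : B) - algebraMap O _ (l w)), ?_, ?_⟩
  · change affinoidEnvelopeCharacter O f _ = 0
    have h2 := (represents_toCompletion (J := maximalIdeal O)
      (UniversalEnvelopingAlgebra.ι O (⟨w, hw⟩ : B) - algebraMap O _ (l w))).completionCharacter_sub_mem
      (UniversalEnvelopingAlgebra.lift O f)
    rw [map_sub, UniversalEnvelopingAlgebra.lift_ι_apply, AlgHom.commutes, hf] at h2
    have h3 : completionCharacter (maximalIdeal O) (UniversalEnvelopingAlgebra.lift O f)
        (toCompletion (maximalIdeal O) _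
          (UniversalEnvelopingAlgebra.ι O (⟨w, hw⟩ : B) - algebraMap O _ (l w))) = 0 := by
      refine IsHausdorff.haus (I := maximalIdeal O) inferInstance _ fun n ↦ ?_
      rw [SModEq.zero, smul_eq_mul, Ideal.mul_top]
      have h4 := neg_mem (h2 n)
      rwa [Algebra.algebraMap_self_apply, sub_self, zero_sub, neg_neg] at h4
    rw [affinoidEnvelopeCharacter, Algebra.TensorProduct.lift_tmul, map_one, one_mul]
    exact (congrArg (algebraMap O K) h3).trans (map_zero _)
  · change (1 : K) ⊗ₜ[O] completionMap (maximalIdeal O) (envelopingIncl B)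
      (toCompletion (maximalIdeal O) _ _) = 1 ⊗ₜ toCompletion (maximalIdeal O) _ _
    have h2 : completionMap (maximalIdeal O) (envelopingIncl B) (toCompletion (maximalIdeal O) _
        (UniversalEnvelopingAlgebra.ι O (⟨w, hw⟩ : B) - algebraMap O _ (l w))) =
        toCompletion (maximalIdeal O) _ (envelopingIncl B
          (UniversalEnvelopingAlgebra.ι O (⟨w, hw⟩ : B) - algebraMap O _ (l w))) := rfl
    rw [h2, map_sub, envelopingIncl_ι, AlgHom.commutes]

/-- The annihilator of an induced module attached to a Lagrangian subalgebra of a lattice does not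
depend on the subalgebra. -/
theorem annihilator_eq_of_isLagrangian [CharZero O] {B' : LieSubalgebra O L} {f' : B' →ₗ⁅O⁆ O}
    (hB : IsLagrangian l B) (hB' : IsLagrangian l B')
    (hf : ∀ x : B, f x = l x) (hf' : ∀ x : B', f' x = l x) :
    Module.annihilator (AffinoidEnvelope O L)
      (InducedModule (affinoidEnvelopeMap O B.incl).toRingHom
        (CharacterModule (affinoidEnvelopeCharacter O f).toRingHom)) =
    Module.annihilator (AffinoidEnvelope O L)
      (InducedModule (affinoidEnvelopeMap O B'.incl).toRingHom
        (CharacterModule (affinoidEnvelopeCharacter O f').toRingHom)) := by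
  refine annihilator_inducedModule_eq
    (I := extendedIdeal (closedIdeal (maximalIdeal O) l B))
    (I' := extendedIdeal (closedIdeal (maximalIdeal O) l B'))
    (affinoidEnvelopeMap_sub_mem_extendedIdeal hf)
    (extendedIdeal_le_span hf hB.isolator_eq fun _ hu _ hw ↦ hB.lie_eq_zero hu hw)
    (affinoidEnvelopeMap_sub_mem_extendedIdeal hf')
    (extendedIdeal_le_span hf' hB'.isolator_eq fun _ hu _ hw ↦ hB'.lie_eq_zero hu hw) fun y ↦ ?_
  obtain ⟨t, ht, x, hx⟩ := exists_smul_eq_one_tmul y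
  obtain ⟨a, ha⟩ := exists_represents x
  rw [forall_mul_mem_extendedIdeal_iff (fun t ht c hc ↦ mem_closedIdeal_of_smul_mem hB.isolator_eq
      (fun _ hu _ hw ↦ hB.lie_eq_zero hu hw) ht hc) ht hx,
    forall_mul_mem_extendedIdeal_iff (fun t ht c hc ↦ mem_closedIdeal_of_smul_mem hB'.isolator_eq
      (fun _ hu _ hw ↦ hB'.lie_eq_zero hu hw) ht hc) ht hx,
    ha.forall_mul_mem_closedIdeal_iff, ha.forall_mul_mem_closedIdeal_iff,
    annihilates_iff_of_isLagrangian hB hB' ha.isCompatible]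

end AffinoidAnnihilator

/-! ### Finite generation of separated lattices -/

section FiniteLattice

variable {R : Type*} [CommRing R] {I : Ideal R} {M : Type*} [AddCommGroup M] [Module R M]

theorem isPrecomplete_pi (ι : Type*) [Finite ι] [IsPrecomplete I R] : IsPrecomplete I (ι → R) := by
  have := Fintype.ofFinite ι
  refine ⟨fun f hf ↦ ?_⟩
  have h (i : ι) : ∃ a : R, ∀ n, f n i ≡ a [SMOD (I ^ n • ⊤ : Submodule R R)] := by
    refine IsPrecomplete.prec ‹_› fun {m n} hmn ↦ ?_
    refine ((hf hmn).map (LinearMap.proj i)).mono ?_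
    rw [Submodule.map_smul'']
    exact Submodule.smul_mono le_rfl le_top
  choose a ha using h
  refine ⟨a, fun n ↦ SModEq.sub_mem.mpr ?_⟩
  classical
  rw [pi_eq_sum_univ (f n - a)]
  refine Submodule.sum_mem _ fun i _ ↦ Submodule.smul_mem_smul ?_ trivial
  simpa [SModEq.sub_mem] using ha i n

/-- The coefficients of a relation are divisible by the uniformiser, and torsion-freeness lets one
divide and repeat; so they lie in every power of the maximal ideal. -/
theorem linearIndependent_of_mkQ [IsDomain R] [IsDiscreteValuationRing R]
    [Module.IsTorsionFree R M] {ι : Type*} {v : ι → M}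
    (h : LinearIndependent (R ⧸ maximalIdeal R)
      fun i ↦ (maximalIdeal R • (⊤ : Submodule R M)).mkQ (v i)) :
    LinearIndependent R v := by
  obtain ⟨ϖ, hϖ⟩ := IsDiscreteValuationRing.exists_irreducible R
  have key (n : ℕ) : ∀ (s : Finset ι) (c : ι → R), ∑ i ∈ s, c i • v i = 0 →
      ∀ i ∈ s, c i ∈ maximalIdeal R ^ n := by
    induction n with
    | zero => simp
    | succ n ih =>
      intro s c hc i hi
      have hm : ∀ i ∈ s, ∃ d, c i = ϖ * d := by
        intro i hi
        have h0 := linearIndependent_iff'.mp h s (fun i ↦ Ideal.Quotient.mk _ (c i)) (by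
          have := congrArg (maximalIdeal R • (⊤ : Submodule R M)).mkQ hc
          rw [map_sum, map_zero] at this
          exact this) i hi
        rw [Ideal.Quotient.eq_zero_iff_mem, hϖ.maximalIdeal_eq, Ideal.mem_span_singleton] at h0
        exact h0
      choose! d hd using hm
      have hd0 : ∑ i ∈ s, d i • v i = 0 := by
        refine (smul_eq_zero_iff_right hϖ.ne_zero).mp ?_
        rw [Finset.smul_sum, ← hc]
        exact Finset.sum_congr rfl fun i hi ↦ by rw [hd i hi, mul_smul]
      rw [hd i hi, pow_succ']
      exact Ideal.mul_mem_mul (hϖ.maximalIdeal_eq ▸ Ideal.mem_span_singleton_self ϖ)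
        (ih s d hd0 i hi)
  refine linearIndependent_iff'.mpr fun s c hc i hi ↦ ?_
  have : c i ∈ ⨅ n : ℕ, maximalIdeal R ^ n := by
    simpa using fun n ↦ key n s c hc i hi
  rwa [Ideal.iInf_pow_eq_bot_of_isLocalRing _ (Ideal.IsPrime.ne_top inferInstance)] at this

/-- A separated torsion-free module of finite rank over a complete discrete valuation ring is
finitely generated. -/
theorem finite_of_isHausdorff [IsDomain R] [IsDiscreteValuationRing R]
    [IsAdicComplete (maximalIdeal R) R] [Module.IsTorsionFree R M]
    [IsHausdorff (maximalIdeal R) M] (hM : Module.rank R M < Cardinal.aleph0) :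
    Module.Finite R M := by
  let _ : Field (R ⧸ maximalIdeal R) := Ideal.Quotient.field _
  let V := M ⧸ maximalIdeal R • (⊤ : Submodule R M)
  let b := Module.Basis.ofVectorSpace (R ⧸ maximalIdeal R) V
  choose v hv using fun i ↦ Submodule.mkQ_surjective (maximalIdeal R • (⊤ : Submodule R M)) (b i)
  -- Lifts of a residue basis are independent, so finite rank bounds the dimension of the residue
  -- space.
  have hli : LinearIndependent R v := linearIndependent_of_mkQ <| by
    simp only [hv]
    exact b.linearIndependent
  have : Finite (Module.Basis.ofVectorSpaceIndex (R ⧸ maximalIdeal R) V) :=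
    Cardinal.lt_aleph0_iff_finite.mp (hli.cardinal_le_rank.trans_lt hM)
  have : Module.Finite (R ⧸ maximalIdeal R) V := .of_basis b
  have : Module.Finite R V := .trans (R ⧸ maximalIdeal R) V
  obtain ⟨n, f, hf⟩ := Module.Finite.exists_fin' R V
  obtain ⟨F, hF⟩ := Module.projective_lifting_property
    (maximalIdeal R • (⊤ : Submodule R M)).mkQ f (Submodule.mkQ_surjective _)
  have : IsPrecomplete (maximalIdeal R) (Fin n → R) := isPrecomplete_pi _
  -- Surjectivity modulo the maximal ideal lifts, the source being complete and the target
  -- separated.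
  exact .of_surjective F <|
    surjective_of_mkQ_comp_surjective (I := maximalIdeal R) (by rw [hF]; exact hf)

end FiniteLattice

/-! ### The valuation ring of a `p`-adic field -/

section PadicIntegers

variable (p : ℕ) [Fact p.Prime] (K : Type*) [Field K] [Algebra ℚ_[p] K] [FiniteDimensional ℚ_[p] K]

open scoped Valued in
-- `K` is locally compact, so its closed unit ball is compact, and a compact valuation ring of a
-- nontrivial valuation is discrete.
instance isDiscreteValuationRing_integers : IsDiscreteValuationRing (integers p K) := by
  let i := spectralNorm.nontriviallyNormedField ℚ_[p] K
  let j : NormedAlgebra ℚ_[p] K := spectralNorm.normedAlgebra ℚ_[p] K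
  have hu : IsUltrametricDist K := IsUltrametricDist.of_normedAlgebra ℚ_[p]
  have hp : ProperSpace K := FiniteDimensional.proper ℚ_[p] K
  let v : Valued K NNReal := NormedField.toValued
  let e : 𝒪[K] ≃+* integers p K :=
    { toFun := fun x ↦ ⟨x.1, x.2⟩
      invFun := fun x ↦ ⟨x.1, x.2⟩
      left_inv := fun _ ↦ rfl
      right_inv := fun _ ↦ rfl
      map_mul' := fun _ _ ↦ rfl
      map_add' := fun _ _ ↦ rfl }
  have hc : CompactSpace 𝒪[K] := by
    refine isCompact_iff_compactSpace.mp ?_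
    change IsCompact {x | x ∈ integers p K}
    have h : {x | x ∈ integers p K} = Metric.closedBall (0 : K) 1 := by
      ext x
      simp only [Set.mem_ofPred_eq, mem_closedBall_zero_iff]
      rfl
    exact h ▸ isCompact_closedBall (0 : K) 1
  have : (Valued.v : Valuation K NNReal).IsNontrivial := by
    obtain ⟨x, h1⟩ := NormedField.exists_one_lt_norm K
    refine ⟨x, fun h ↦ ?_, fun h ↦ ?_⟩
    · simp only [map_eq_zero] at h
      rw [h, norm_zero] at h1
      exact absurd h1 (not_lt.mpr zero_le_one)
    · exact h1.ne' (congrArg NNReal.toReal h)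
  have : IsDiscreteValuationRing 𝒪[K] := Valued.integer.isDiscreteValuationRing_of_compactSpace
  exact IsDiscreteValuationRing.RingEquivClass.isDiscreteValuationRing e

theorem charZero_integers : CharZero (integers p K) :=
  have : CharZero K := charZero_of_injective_algebraMap (algebraMap ℚ_[p] K).injective
  ⟨fun m n h ↦ by simpa using congrArg Subtype.val h⟩

end PadicIntegers

/-! ### From polarisations to Lagrangian subalgebras of the lattice -/

section Lattice

variable {K : Type*} [Field K] {O : ValuationSubring K} {g : Type*} [LieRing g] [LieAlgebra K g]
  {L : LieSubalgebra O g}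

instance : Module.IsTorsionFree O g := .trans K

instance : Module.IsTorsionFree O L := inferInstanceAs (Module.IsTorsionFree O L.toSubmodule)

theorem isHausdorff_of_isOLattice (hL : IsOLattice O L.toSubmodule) :
    IsHausdorff (maximalIdeal O) L := by
  refine ⟨fun x hx ↦ ?_⟩
  have : (x : g) ∈ ⨅ n : ℕ, (maximalIdeal O) ^ n • L.toSubmodule := by
    refine Submodule.mem_iInf _ |>.mpr fun n ↦ ?_
    have h := Submodule.mem_map_of_mem (f := L.toSubmodule.subtype) (SModEq.zero.mp (hx n))
    rw [Submodule.map_smul''] at h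
    refine Submodule.smul_mono le_rfl ?_ h
    rintro _ ⟨y, -, rfl⟩
    exact y.2
  rw [hL.iInf_eq_bot] at this
  exact Subtype.ext this

theorem rank_lt_aleph0 [FiniteDimensional K g] : Module.rank O L < Cardinal.aleph0 := by
  refine (Submodule.rank_le L.toSubmodule).trans_lt ?_
  rw [← IsLocalization.rank_eq K (nonZeroDivisors O) le_rfl]
  exact Module.rank_lt_aleph0 K g

theorem exists_smul_mem (hL : IsOLattice O L.toSubmodule) (w : g) :
    ∃ t : O, t ≠ 0 ∧ t • w ∈ L := by
  have hw : w ∈ Submodule.span K (L.toSubmodule : Set g) := hL.span_eq_top ▸ trivial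
  induction hw using Submodule.span_induction with
  | mem x hx => exact ⟨1, one_ne_zero, by simpa using hx⟩
  | zero => exact ⟨1, one_ne_zero, by simp⟩
  | add x y _ _ hx hy =>
    obtain ⟨s, hs, hsx⟩ := hx
    obtain ⟨t, ht, hty⟩ := hy
    refine ⟨s * t, mul_ne_zero hs ht, ?_⟩
    rw [smul_add]
    refine L.add_mem ?_ ?_
    · rw [mul_comm, mul_smul]
      exact L.smul_mem _ hsx
    · rw [mul_smul]
      exact L.smul_mem _ hty
  | smul a x _ hx =>
    obtain ⟨s, hs, hsx⟩ := hx
    obtain ⟨t, ht, c, hc⟩ : ∃ t : O, t ≠ 0 ∧ ∃ c : O, (t : K) * a = c := by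
      obtain ⟨c, t, ht, rfl⟩ := IsFractionRing.div_surjective (A := O) a
      refine ⟨t, nonZeroDivisors.ne_zero ht, c, mul_div_cancel₀ _ ?_⟩
      simpa using nonZeroDivisors.ne_zero ht
    refine ⟨t * s, mul_ne_zero ht hs, ?_⟩
    have : (t * s) • a • x = c • s • x := by
      change ((t * s : O) : K) • a • x = (c : K) • (s : K) • x
      rw [smul_smul, smul_smul, ← hc]
      congr 1
      push_cast
      ring
    rw [this]
    exact L.smul_mem _ hsx

/-- The restriction to `L` of a linear form which maps `L` to `O`. -/
def latticeForm (L : LieSubalgebra O g) (l : Module.Dual K g) (hl : ∀ x ∈ L, l x ∈ O) :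
    L →ₗ[O] O where
  toFun x := ⟨l x, hl x x.2⟩
  map_add' _ _ := Subtype.ext (map_add l _ _)
  map_smul' r _ := Subtype.ext (map_smul l (r : K) _)

theorem IsPolarisation.isLagrangian_latticePart (hL : IsOLattice O L.toSubmodule)
    {l : Module.Dual K g} (hl : ∀ x ∈ L, l x ∈ O) {b : LieSubalgebra K g}
    (hb : IsPolarisation l b) : IsLagrangian (latticeForm L l hl) (latticePart L b) := by
  intro u
  refine ⟨fun hu w hw ↦ Subtype.ext ((hb.forall_lie_eq_zero_iff _).mpr hu _ hw),
    fun hu ↦ (hb.forall_lie_eq_zero_iff _).mp fun w hw ↦ ?_⟩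
  -- Orthogonality is known only against `b ∩ L`; a nonzero multiple of `w` lies there, and the
  -- scalar cancels in `K`.
  obtain ⟨t, ht, htw⟩ := exists_smul_mem hL w
  have h := congrArg Subtype.val (hu ⟨t • w, htw⟩ (b.smul_mem (t : K) hw))
  change l ⁅(u : g), (t : K) • w⁆ = 0 at h
  rw [lie_smul, map_smul, smul_eq_mul, mul_eq_zero] at h
  exact h.resolve_left fun h0 ↦ ht (Subtype.ext h0)

end Lattice

end AffinoidDixmier

end

theorem mainTheorem4 (p : ℕ) [Fact p.Prime] (K : Type*) [Field K] [Algebra ℚ_[p] K]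
    [FiniteDimensional ℚ_[p] K] (g : Type*) [LieRing g] [LieAlgebra K g] [FiniteDimensional K g]
    [LieRing.IsNilpotent g] (L : LieSubalgebra (AffinoidDixmier.integers p K) g)
    (hL : AffinoidDixmier.IsOLattice (AffinoidDixmier.integers p K) L.toSubmodule)
    (l : Module.Dual K g) (hl : ∀ x ∈ L, l x ∈ AffinoidDixmier.integers p K)
    (b₁ b₂ : LieSubalgebra K g)
    (hb₁ : AffinoidDixmier.IsPolarisation l b₁) (hb₂ : AffinoidDixmier.IsPolarisation l b₂) :
    Module.annihilator (AffinoidDixmier.AffinoidEnvelope (AffinoidDixmier.integers p K) L)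
        (AffinoidDixmier.AffinoidDixmierModule L l hl b₁ hb₁) =
      Module.annihilator (AffinoidDixmier.AffinoidEnvelope (AffinoidDixmier.integers p K) L)
        (AffinoidDixmier.AffinoidDixmierModule L l hl b₂ hb₂) := by
  have := AffinoidDixmier.charZero_integers p K
  have := AffinoidDixmier.isHausdorff_of_isOLattice hL
  have : Module.Finite (AffinoidDixmier.integers p K) L :=
    AffinoidDixmier.finite_of_isHausdorff AffinoidDixmier.rank_lt_aleph0
  exact AffinoidDixmier.annihilator_eq_of_isLagrangian (hb₁.isLagrangian_latticePart hL hl)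
    (hb₂.isLagrangian_latticePart hL hl) (fun _ ↦ rfl) (fun _ ↦ rfl)
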